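/- For multi-valued functions on represented spaces and the additional top element $\infty$, let $\leq_{\mathrm W}$ be Weihrauch reducibility, $\equiv_{\mathrm W}$ the induced equivalence and $<_{\mathrm W}$ strict reducibility, let $f\times g$ be the product, let $f\star g:=(\mathrm{id}_{\mathbb N^{\mathbb N}}\times f)\circ g^{\mathrm t}$ be the compositional product, where $g^{\mathrm t}(h,x)=h\circ g(x)$ for points $x$ and strongly continuous multi-valued functions $h:\subseteq\mathbf Y\rightrightarrows\mathbb N^{\mathbb N}\times\mathbf U$ (for $f:\subseteq\mathbf U\rightrightarrows\mathbf V$ and $g:\subseteq\mathbf X\rightrightarrows\mathbf Y$), and let $g\to f$ be the implication, which maps $u\in\operatorname{dom}(f)$ to the pairs $(H,x)$ with $H$ a strongly continuous multi-valued function such that $\emptyset\neq H\circ g(x)\subseteq f(u)$ (and $g\to f:=\infty$ if $\operatorname{dom}(g)=\emptyset\neq\operatorname{dom}(f)$). Here $x\in\operatorname{dom}(h\circ g)$ iff $\emptyset\neq g(x)\subseteq\operatorname{dom}(h)$, and $h:\subseteq\mathbf A\rightrightarrows\mathbf B$ is strongly continuous if $h=\delta_B\circ\Phi_p\circ(\delta_A^{\mathrm{cyl}})^{-1}$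 for some $p\in\mathbb N^{\mathbb N}$, where $\Phi_p$ is the partial function on Baire space computed by a fixed universal machine with oracle $p$ and $\delta_A^{\mathrm{cyl}}\langle q,r\rangle=\delta_A(q)$. Conventions for $\infty$: $f\times\infty=\infty\times f=f\star\infty=\infty\star f=\infty$, $(\infty\to f)=0$ (the nowhere defined problem), and $(g\to\infty)=\infty$ for $g\neq\infty$. Let $1$ be the identity on a one-point space, $\lim$ the limit map $\lim(p)(n)=\lim_{i\to\infty}p(\langle n,i\rangle)$ on Baire space, $\mathsf{LPO}:\{0,1\}^{\mathbb N}\to\{0,1\}$ the map with $\mathsf{LPO}(p)=1\iff p=0^{\mathbb N}$, and $c_p:1\to\{p\}$, $d_p:\{p\}\to 1$ the unique maps for $p\in\{0,1\}^{\mathbb N}$. Then, up to $\equiv_{\mathrm W}$: (1) $\times$ and $\star$ are associative, $\to$ is not. (2) $\times$ and $\star$ are monotone in both components with respect to $\leq_{\mathrm W}$. (3) $\to$ is monotone in the second component and antimonotone in the first component. (4) $\times$ is commutative, $\star$ and $\to$ are not. Counterexamples for the negative statements are: $\lim\star\mathsf{LPO}\equiv_{\mathrm W}\lim<_{\mathrm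 W}\mathsf{LPO}\star\lim$; $(\lim\to1)\equiv_{\mathrm W}1<_{\mathrm W}\lim\equiv_{\mathrm W}(1\to\lim)$; $(\lim\to(\lim\to\lim))\equiv_{\mathrm W}1<_{\mathrm W}\lim\equiv_{\mathrm W}((\lim\to\lim)\to\lim)$; and, for every non-computable $p\in\{0,1\}^{\mathbb N}$, $((d_p\to1)\to1)\equiv_{\mathrm W}(c_p\to1)\equiv_{\mathrm W}1<_{\mathrm W}c_p\equiv_{\mathrm W}(d_p\to(1\to1))$. -/

import Mathlib

open Filter Topology

universe u

namespace Weihrauch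

/-! ### Computability on Baire space -/

/-- Baire space. -/
abbrev Baire : Type := ℕ → ℕ

/-- The standard (bijective) pairing `⟨p, q⟩` on Baire space. -/
def pairB (p q : Baire) : Baire := fun n => Nat.pair (p n) (q n)

/-- First component of a pair in Baire space. -/
def fstB (r : Baire) : Baire := fun n => (Nat.unpair (r n)).1

/-- Second component of a pair in Baire space. -/
def sndB (r : Baire) : Baire := fun n => (Nat.unpair (r n)).2

/-- A code for the finite prefix `q(0) ⋯ q(k-1)`. -/
def prefixCode (q : Baire) (k : ℕ) : ℕ := Encodable.encode ((List.range k).map q)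

/-- The universal function `Φ`. The universal machine on input `⟨p, q⟩` does the following for
`n = 0, 1, 2, …`: it searches for the least `k` such that `p` assigns a nonzero number `m + 1` to
the pair of `n` and the prefix of `q` of length `k`, and then writes `m` as the `n`-th output digit.
`Φ p q` is defined exactly if infinitely many digits are written. This machine is universal: a
machine with input `q` (and a parameter from Baire space) is turned into a `p`, computable from
the parameter, by letting `p` answer `m + 1` on `n` and `σ` if the machine has written `m` as its
`n`-th digit within `length σ` steps using only the input prefix `σ`, and `0` otherwise. -/
def Φ (p : Baire) : Baire →. Baire := fun q =>
  ⟨∀ n, ∃ k, p (Nat.pair n (prefixCode q k)) ≠ 0,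
    fun h n => p (Nat.pair n (prefixCode q (Nat.find (h n)))) - 1⟩

/-- A partial function on Baire space is computable if it is a restriction of some `Φ p` with
computable `p`. -/
def ComputableFun (F : Baire →. Baire) : Prop :=
  ∃ p : Baire, Computable p ∧ ∀ q r, r ∈ F q → r ∈ Φ p q

/-! ### Multi-valued functions -/

/-- Partial multi-valued functions from `α` to `β`; `f x = ∅` means that `x` is not in the domain. -/
abbrev Multi (α β : Type*) := α → Set β

namespace Multi

variable {α β γ ε : Type*}

/-- The domain of a multi-valued function. -/
def dom (f : Multi α β) : Set α := {x | (f x).Nonempty}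

/-- Composition of multi-valued functions: `x` is in the domain of `f ∘ g` only if all of `g x` is
contained in the domain of `f`. -/
def comp (f : Multi β γ) (g : Multi α β) : Multi α γ :=
  fun x => {z | (∀ y ∈ g x, y ∈ f.dom) ∧ ∃ y ∈ g x, z ∈ f y}

/-- A partial single-valued function as a multi-valued function. -/
def ofPart (F : α →. β) : Multi α β := fun x => {y | y ∈ F x}

/-- The multi-valued inverse of a partial function. -/
def inv (F : α →. β) : Multi β α := fun y => {x | y ∈ F x}

/-- The identity. -/
def ident (α : Type*) : Multi α α := fun x => {x}

/-- The product of multi-valued functions. -/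
def prod (f : Multi α β) (g : Multi γ ε) : Multi (α × γ) (β × ε) := fun a => f a.1 ×ˢ g a.2

end Multi

/-! ### Represented spaces -/

/-- A represented space: a set with a partial surjection from Baire space. -/
structure RepSpace : Type (u + 1) where
  /-- the underlying set -/
  carrier : Type u
  /-- the representation -/
  δ : Baire →. carrier
  surj : ∀ x, ∃ p, x ∈ δ p

namespace RepSpace

/-- The one point space `1` with its total representation. -/
def one : RepSpace.{u} where
  carrier := PUnit
  δ := fun _ => Part.some PUnit.unit
  surj := fun x => ⟨fun _ => 0, by cases x; exact Part.mem_some _⟩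

/-- Baire space, represented by the identity. -/
def baire : RepSpace.{u} where
  carrier := ULift.{u} Baire
  δ := fun p => Part.some ⟨p⟩
  surj := fun x => ⟨x.down, Part.mem_some _⟩

/-- Cantor space as a subspace of Baire space. -/
def cantor : RepSpace.{u} where
  carrier := ULift.{u} (ℕ → Fin 2)
  δ := fun p => ⟨∀ n, p n < 2, fun h => ⟨fun n => ⟨p n, h n⟩⟩⟩
  surj := fun x => ⟨fun n => (x.down n : ℕ), ⟨fun n => (x.down n).isLt, rfl⟩⟩

/-- The discrete space `{0, 1}`; a name of `b` is any sequence that starts with `b`. -/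
def two : RepSpace.{u} where
  carrier := ULift.{u} (Fin 2)
  δ := fun p => ⟨p 0 < 2, fun h => ⟨⟨p 0, h⟩⟩⟩
  surj := fun x => ⟨fun _ => (x.down : ℕ), ⟨x.down.isLt, rfl⟩⟩

/-- The subspace of a represented space on a subset. -/
def sub (X : RepSpace.{u}) (S : Set X.carrier) : RepSpace.{u} where
  carrier := {x // x ∈ S}
  δ := fun p => ⟨∃ h : (X.δ p).Dom, (X.δ p).get h ∈ S, fun h => ⟨(X.δ p).get h.1, h.2⟩⟩
  surj := by
    rintro ⟨x, hx⟩
    obtain ⟨p, h, rfl⟩ := X.surj x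
    exact ⟨p, ⟨h, hx⟩, rfl⟩

/-- The product of represented spaces. -/
def prod (X Y : RepSpace.{u}) : RepSpace.{u} where
  carrier := X.carrier × Y.carrier
  δ := fun r => ⟨(X.δ (fstB r)).Dom ∧ (Y.δ (sndB r)).Dom,
    fun h => ((X.δ (fstB r)).get h.1, (Y.δ (sndB r)).get h.2)⟩
  surj := by
    rintro ⟨x, y⟩
    obtain ⟨p, hp⟩ := X.surj x
    obtain ⟨q, hq⟩ := Y.surj y
    have e1 : fstB (pairB p q) = p := by funext n; simp [fstB, pairB]
    have e2 : sndB (pairB p q) = q := by funext n; simp [sndB, pairB]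
    rw [← e1] at hp
    rw [← e2] at hq
    obtain ⟨h1, rfl⟩ := hp
    obtain ⟨h2, rfl⟩ := hq
    exact ⟨pairB p q, ⟨h1, h2⟩, rfl⟩

/-- The cylindrification `⟨p, q⟩ ↦ δ p` of the representation of `X`. -/
def cyl (X : RepSpace.{u}) : Baire →. X.carrier := fun r => X.δ (fstB r)

/-- The strongly continuous multi-valued function `δ_Y ∘ Φ_p ∘ (δ_X^cyl)⁻¹` from `X` to `Y`. -/
def phi (X Y : RepSpace.{u}) (p : Baire) : Multi X.carrier Y.carrier :=
  (Multi.ofPart Y.δ).comp ((Multi.ofPart (Φ p)).comp (Multi.inv X.cyl))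

/-- The represented space `M(X, Y)` of strongly continuous multi-valued functions. -/
def M (X Y : RepSpace.{u}) : RepSpace.{u} where
  carrier := {h : Multi X.carrier Y.carrier // ∃ p, h = phi X Y p}
  δ := fun p => Part.some ⟨phi X Y p, p, rfl⟩
  surj := by
    rintro ⟨h, p, rfl⟩
    exact ⟨p, Part.mem_some _⟩

end RepSpace

/-- Partial multi-valued functions between represented spaces. -/
abbrev MultiFun (X Y : RepSpace.{u}) := Multi X.carrier Y.carrier

/-- `F` is a realizer of `f`. -/
def Realizes {X Y : RepSpace.{u}} (F : Baire →. Baire) (f : MultiFun X Y) : Prop :=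
  ∀ p, ∀ x ∈ X.δ p, x ∈ f.dom → ∃ r ∈ F p, ∃ y ∈ Y.δ r, y ∈ f x

/-! ### Problems and Weihrauch reducibility -/

/-- Representatives of Weihrauch degrees: multi-valued functions on represented spaces, together
with the additional top element `∞`. -/
inductive Problem : Type (u + 1)
  | of {X Y : RepSpace.{u}} (f : MultiFun X Y) : Problem
  | infty : Problem

/-- The realizers of a problem; `∞` has none. -/
def Problem.realizers : Problem.{u} → Set (Baire →. Baire)
  | .of f => {F | Realizes F f}
  | .infty => ∅

/-- Weihrauch reducibility: there are computable `K`, `H` such that `K⟨id, G H⟩` realizes `f`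
for every realizer `G` of `g`. -/
def WLE (f g : Problem.{u}) : Prop :=
  ∃ K H : Baire →. Baire, ComputableFun K ∧ ComputableFun H ∧
    ∀ G ∈ g.realizers,
      (fun p => (H p).bind fun a => (G a).bind fun b => K (pairB p b)) ∈ f.realizers

/-- Weihrauch equivalence, i.e. equality of Weihrauch degrees. -/
def WEquiv (f g : Problem.{u}) : Prop := WLE f g ∧ WLE g f

/-- Strict Weihrauch reducibility. -/
def WLT (f g : Problem.{u}) : Prop := WLE f g ∧ ¬ WLE g f

/-! ### The operations -/

/-- The transposition `(h, x) ↦ (h ∘ g)(x)` of `g` with respect to `U`. -/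
def transpose {X Y : RepSpace.{u}} (g : MultiFun X Y) (U : RepSpace.{u}) :
    MultiFun ((RepSpace.M Y U).prod X) U :=
  fun a => (Multi.comp a.1.1 g) a.2

/-- The compositional product `(id × f) ∘ gᵗ` of multi-valued functions. -/
def starFun {U V X Y : RepSpace.{u}} (f : MultiFun U V) (g : MultiFun X Y) :
    MultiFun ((RepSpace.M Y (RepSpace.baire.prod U)).prod X) (RepSpace.baire.prod V) :=
  Multi.comp (Multi.prod (Multi.ident RepSpace.baire.carrier) f)
    (transpose g (RepSpace.baire.prod U))

/-- The implication `g → f` of multi-valued functions: a solution for `u` is a pair `(H, x)` such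
that `H ∘ g` is defined at `x` and `(H ∘ g)(x) ⊆ f(u)`. -/
def implFun {U V X Y : RepSpace.{u}} (g : MultiFun X Y) (f : MultiFun U V) :
    MultiFun U ((RepSpace.M Y V).prod X) :=
  fun u => {a | ((Multi.comp a.1.1 g) a.2).Nonempty ∧ (Multi.comp a.1.1 g) a.2 ⊆ f u}

namespace Problem

/-- The nowhere defined problem, a representative of the bottom degree `0`. -/
def zero : Problem.{u} := of (X := RepSpace.baire) (Y := RepSpace.baire) fun _ => ∅

/-- The identity on the one point space, a representative of the degree `1`. -/
def one : Problem.{u} :=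
  of (X := RepSpace.one) (Y := RepSpace.one) (Multi.ident RepSpace.one.carrier)

/-- The product `f × g`, with `f × ∞ = ∞ × g = ∞`. -/
def times : Problem.{u} → Problem.{u} → Problem.{u}
  | @of X Y f, @of U V g => of (X := X.prod U) (Y := Y.prod V) (Multi.prod f g)
  | _, _ => infty

/-- The compositional product `f ⋆ g`, with `f ⋆ ∞ = ∞ ⋆ g = ∞`. -/
def star : Problem.{u} → Problem.{u} → Problem.{u}
  | of f, of g => of (starFun f g)
  | _, _ => infty

open Classical in
/-- The implication: `impl g f` is `g → f`. It is `∞` if `g` has empty domain while `f` has not;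
`∞ → f` is `0`, and `g → ∞` is `∞` for `g ≠ ∞`. -/
noncomputable def impl : Problem.{u} → Problem.{u} → Problem.{u}
  | infty, _ => zero
  | of _, infty => infty
  | of g, of f => if g.dom.Nonempty ∨ f.dom = ∅ then of (implFun g f) else infty

/-! ### The special problems -/

/-- `lim`, mapping `p` to the sequence of the limits `lim_i p⟨n, i⟩` if all of them exist. -/
def lim : Problem.{u} :=
  of (X := RepSpace.baire) (Y := RepSpace.baire) fun p =>
    {r | ∀ n, Tendsto (fun i => p.down (Nat.pair n i)) atTop (𝓝 (r.down n))}

open Classical in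
/-- `LPO`, mapping the zero sequence to `1` and all other binary sequences to `0`. -/
noncomputable def LPO : Problem.{u} :=
  of (X := RepSpace.cantor) (Y := RepSpace.two) fun p =>
    {if ∀ n, p.down n = 0 then ⟨1⟩ else ⟨0⟩}

/-- The subspace `{p}` of Cantor space. -/
def point (p : ℕ → Fin 2) : RepSpace.{u} := RepSpace.cantor.sub {⟨p⟩}

/-- `c_p : 1 → {p}`. -/
def c (p : ℕ → Fin 2) : Problem.{u} :=
  of (X := RepSpace.one) (Y := point p) fun _ => Set.univ

/-- `d_p : {p} → 1`. -/
def d (p : ℕ → Fin 2) : Problem.{u} :=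
  of (X := point p) (Y := RepSpace.one) fun _ => Set.univ

end Problem

end Weihrauch

/-! Everything is moved to Baire space. A multi-valued function `f` induces the relation `nameRel f`
between names of instances and names of their solutions, and reducibility, `×`, `⋆` and `→` can be
read off from these relations (`wle_of_iff`, `nameRel_prod`, `nameRel_star`, `nameRel_impl`); `∞` is
treated by cases. The unused half of a cylinder name becomes a free padding argument `r` of the
codes.

On names, the positive laws are program transformations. The computable functions are those with a
monotone computable approximation on finite prefixes (`Approx`). This yields closure under
composition and under evaluation of `Φ`, and a parametrization theorem (`ComputableFun.smn`), which
turns "translate the answer, then call `h`" into a code computable from the data. Monotonicity and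
associativity follow by writing down such codes.

The counterexamples for `→` rest on four equivalences: `1 → f ≡ f` for `f ≠ ∞`; `(f → 1) ≡ 1` if `f`
has a computable instance; `(lim → lim) ≡ 1`; and `(d_p → 1) ≡ c_p`, since a solution must supply
the only instance `p` of `d_p`. They separate because `lim` is discontinuous and because computable
functions map computable points to computable points.

For `⋆`, the answer of `LPO` can be guessed in the limit, so `lim` absorbs it: `lim ⋆ LPO ≡ lim`. In
contrast, `LPO ⋆ lim` decides whether all rows of a double sequence are nonzero. A reduction to
`lim` would cover Baire space by countably many closed sets on each of which the answer is constant.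
By the Baire category theorem one of them has an interior point, but both answers occur densely
(`not_LPO_star_le_lim`). -/

namespace Weihrauch

/-! ### Continuous functions on Baire space through monotone approximations -/

/-- The prefix of length `k` of a point of Baire space. -/
def initSeg (q : Baire) (k : ℕ) : List ℕ := (List.range k).map q

@[simp] theorem length_initSeg (q : Baire) (k : ℕ) : (initSeg q k).length = k := by
  simp [initSeg]

theorem initSeg_succ (q : Baire) (k : ℕ) : initSeg q (k + 1) = initSeg q k ++ [q k] := by
  simp [initSeg, List.range_succ]

theorem take_initSeg (q : Baire) {k l : ℕ} (h : k ≤ l) :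
    (initSeg q l).take k = initSeg q k := by
  simp [initSeg, ← List.map_take, List.take_range, h]

theorem initSeg_prefix (q : Baire) {k l : ℕ} (h : k ≤ l) : initSeg q k <+: initSeg q l := by
  rw [← take_initSeg q h]; exact List.take_prefix _ _

theorem getElem?_initSeg (q : Baire) {j k : ℕ} (h : j < k) : (initSeg q k)[j]? = some (q j) := by
  simp [initSeg, h]

@[simp] theorem getElem_initSeg (q : Baire) {j k : ℕ} (h : j < (initSeg q k).length) :
    (initSeg q k)[j] = q j := by
  simp [initSeg]

theorem prefixCode_eq (q : Baire) (k : ℕ) : prefixCode q k = Encodable.encode (initSeg q k) := rfl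

theorem initSeg_congr {q r : Baire} {k : ℕ} (h : ∀ j < k, q j = r j) :
    initSeg q k = initSeg r k := by
  simp only [initSeg]
  exact List.map_congr_left fun j hj => h j (List.mem_range.1 hj)

theorem getElem?_of_prefix {σ τ : List ℕ} (h : σ <+: τ) {j m : ℕ} (hj : σ[j]? = some m) :
    τ[j]? = some m := by
  obtain ⟨t, rfl⟩ := h
  have := (List.getElem?_eq_some_iff.1 hj).1
  rw [List.getElem?_append_left this, hj]

/-- `φ` approximates the partial function `F` on Baire space: `φ σ n` is the `n`-th digit of `F q`,
if that digit has been determined from the prefix `σ` of `q`. -/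
structure Approx (φ : List ℕ → ℕ → Option ℕ) (F : Baire →. Baire) : Prop where
  computable : Computable₂ φ
  mono : ∀ {σ τ n m}, σ <+: τ → φ σ n = some m → φ τ n = some m
  reaches : ∀ q r, r ∈ F q → ∀ n, ∃ k, φ (initSeg q k) n = some (r n)

namespace Approx

variable {φ ψ : List ℕ → ℕ → Option ℕ} {F G : Baire →. Baire}

theorem eq_of_mem (h : Approx φ F) {q r : Baire} (hr : r ∈ F q) {k n m : ℕ}
    (hm : φ (initSeg q k) n = some m) : m = r n := by
  obtain ⟨l, hl⟩ := h.reaches q r hr n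
  have h1 := h.mono (initSeg_prefix q (le_max_left k l)) hm
  have h2 := h.mono (initSeg_prefix q (le_max_right k l)) hl
  rw [h1] at h2
  exact Option.some.inj h2

theorem reaches_all (h : Approx φ F) {q r : Baire} (hr : r ∈ F q) (n : ℕ) :
    ∃ k, ∀ j < n, ∀ l, k ≤ l → φ (initSeg q l) j = some (r j) := by
  choose k hk using h.reaches q r hr
  refine ⟨(Finset.range n).sup k, fun j hj l hl => h.mono (initSeg_prefix q ?_) (hk j)⟩
  exact (Finset.le_sup (f := k) (Finset.mem_range.2 hj)).trans hl

/-- The code of a function with a given approximation. -/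
def code (φ : List ℕ → ℕ → Option ℕ) : Baire := fun m =>
  (((Encodable.decode (α := List ℕ) m.unpair.2).bind fun σ => φ σ m.unpair.1).map Nat.succ).getD 0

theorem code_prefixCode (φ : List ℕ → ℕ → Option ℕ) (q : Baire) (n k : ℕ) :
    code φ (Nat.pair n (prefixCode q k)) = ((φ (initSeg q k) n).map Nat.succ).getD 0 := by
  simp [code, prefixCode_eq]

theorem computable_code (h : Computable₂ φ) : Computable (code φ) := by
  have h1 : Computable fun m : ℕ => m.unpair.1 := Computable.fst.comp Computable.unpair
  have h2 : Computable fun m : ℕ => m.unpair.2 := Computable.snd.comp Computable.unpair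
  refine Computable.option_getD (Computable.option_map (Computable.option_bind
    (Computable.decode.comp h2) ?_) (Computable.succ.comp Computable.snd).to₂) (Computable.const 0)
  exact (h.comp Computable.snd (h1.comp Computable.fst)).to₂

/-- `Φ` reads the first nonzero answer; which `k` gives it is irrelevant, because by `h2` every
answer is right. With `χ` abstract, this serves both plain codes and the parametrized codes of
`smn`. -/
theorem mem_Φ_of_code {χ : ℕ → ℕ → Option ℕ} {p q r : Baire}
    (hp : ∀ n k, p (Nat.pair n (prefixCode q k)) = ((χ n k).map Nat.succ).getD 0)
    (h1 : ∀ n, ∃ k, χ n k = some (r n))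
    (h2 : ∀ n k m, χ n k = some m → m = r n) : r ∈ Φ p q := by
  have hd : ∀ n, ∃ k, p (Nat.pair n (prefixCode q k)) ≠ 0 := fun n => by
    obtain ⟨k, hk⟩ := h1 n
    exact ⟨k, by simp [hp, hk]⟩
  refine ⟨hd, funext fun n => ?_⟩
  have := Nat.find_spec (hd n)
  change p (Nat.pair n (prefixCode q (Nat.find (hd n)))) - 1 = r n
  rw [hp] at this ⊢
  cases hm : χ n (Nat.find (hd n)) with
  | none => simp [hm] at this
  | some m => simp [h2 n _ m hm]

theorem computableFun (h : Approx φ F) : ComputableFun F :=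
  ⟨code φ, computable_code h.computable, fun _ _ hr =>
    mem_Φ_of_code (fun _ _ => code_prefixCode _ _ _ _) (h.reaches _ _ hr)
      fun _ _ _ => h.eq_of_mem hr⟩

/-! #### Composition -/

/-- One step of the enumeration of the digits available from `σ`. -/
def step (φ : List ℕ → ℕ → Option ℕ) (σ l : List ℕ) : List ℕ := l ++ (φ σ l.length).toList

/-- The first (at most `k`) output digits that are available from `σ`. -/
def digits (φ : List ℕ → ℕ → Option ℕ) (σ : List ℕ) (k : ℕ) : List ℕ :=
  Nat.rec [] (fun _ l => step φ σ l) k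

theorem digits_succ (σ : List ℕ) (k : ℕ) :
    digits φ σ (k + 1) = digits φ σ k ++ (φ σ (digits φ σ k).length).toList := rfl

theorem digits_spec (σ : List ℕ) (k j m : ℕ) (h : (digits φ σ k)[j]? = some m) :
    φ σ j = some m := by
  induction k with
  | zero => simp [digits] at h
  | succ k ih =>
    rw [digits_succ] at h
    by_cases hj : j < (digits φ σ k).length
    · exact ih (by rwa [List.getElem?_append_left hj] at h)
    · rw [List.getElem?_append_right (by omega)] at h
      cases hm : φ σ (digits φ σ k).length with
      | none => simp [hm] at h
      | some m' =>
        rw [hm] at h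
        have hlt := (List.getElem?_eq_some_iff.1 h).1
        simp only [Option.toList_some, List.length_singleton] at hlt
        have : j = (digits φ σ k).length := by omega
        subst this
        simp at h
        rw [hm, h]

/-- The enumeration over `τ` may be ahead of the one over `σ`. Then the next digit that `σ`
contributes is already in the longer list, since `digits_spec` and monotonicity leave only one
possible value. -/
theorem digits_prefix (hφ : ∀ {σ τ n m}, σ <+: τ → φ σ n = some m → φ τ n = some m)
    {σ τ : List ℕ} (h : σ <+: τ) (k : ℕ) : digits φ σ k <+: digits φ τ k := by
  induction k with
  | zero => exact List.prefix_rfl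
  | succ k ih =>
    rw [digits_succ]
    cases hm : φ σ (digits φ σ k).length with
    | none => simpa using ih.trans ⟨_, (digits_succ τ k).symm⟩
    | some m =>
      have hτ := hφ h hm
      obtain ⟨t, ht⟩ := ih
      cases t with
      | nil =>
        rw [List.append_nil] at ht
        rw [digits_succ, ← ht, hτ]
      | cons a t =>
        have : (digits φ τ k)[(digits φ σ k).length]? = some a := by simp [← ht]
        have := digits_spec _ _ _ _ this
        rw [hτ] at this
        cases this
        exact List.IsPrefix.trans ⟨t, by simp [← ht]⟩ ⟨_, (digits_succ τ k).symm⟩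

theorem digits_prefix_of_le (σ : List ℕ) {k l : ℕ} (h : k ≤ l) :
    digits φ σ k <+: digits φ σ l := by
  induction h with
  | refl => exact List.prefix_rfl
  | step _ ih => exact ih.trans ⟨_, (digits_succ σ _).symm⟩

theorem digits_eq {σ : List ℕ} {r : Baire} {n : ℕ} (h : ∀ j < n, φ σ j = some (r j)) :
    ∀ k ≤ n, digits φ σ k = initSeg r k := by
  intro k
  induction k with
  | zero => intro; rfl
  | succ k ih =>
    intro hk
    rw [digits_succ, ih (by omega), initSeg_succ, length_initSeg, h k (by omega)]
    rfl

theorem computable_digits (h : Computable₂ φ) :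
    Computable fun σ : List ℕ => digits φ σ σ.length := by
  refine Computable.nat_rec (h := fun σ x => step φ σ x.2) Computable.list_length
    (Computable.const []) ?_
  have h2 : Computable fun y : List ℕ × ℕ × List ℕ => y.2.2 := Computable.snd.comp Computable.snd
  have h3 : Computable fun y : List ℕ × ℕ × List ℕ => φ y.1 y.2.2.length :=
    h.comp Computable.fst (Computable.list_length.comp h2)
  have h4 : Computable fun y : List ℕ × ℕ × List ℕ =>
      ((φ y.1 y.2.2.length).map fun a => y.2.2 ++ [a]).getD y.2.2 :=
    Computable.option_getD (Computable.option_map h3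
      (Computable.list_concat.comp (h2.comp Computable.fst) Computable.snd).to₂) h2
  refine (h4.of_eq fun y => ?_)
  simp only [step]
  cases φ y.1 y.2.2.length <;> simp

/-- `ψ` is fed with the part of the intermediate point known so far. Bounding the enumeration by the
length of `σ` keeps it computable, and every prefix of the intermediate point is still reached as
`σ` grows. -/
theorem comp (hF : Approx φ F) (hG : Approx ψ G) :
    Approx (fun σ n => ψ (digits φ σ σ.length) n) (fun q => (F q).bind G) where
  computable := (hG.computable.comp ((computable_digits hF.computable).comp Computable.fst)
    Computable.snd).to₂
  mono {σ τ n m} h hm := hG.mono ((digits_prefix (φ := φ) (fun {_ _ _ _} => hF.mono) h _).trans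
    (digits_prefix_of_le _ h.length_le)) hm
  reaches q s hs n := by
    obtain ⟨r, hr, hs⟩ := Part.mem_bind_iff.1 hs
    obtain ⟨k, hk⟩ := hG.reaches r s hs n
    obtain ⟨l, hl⟩ := hF.reaches_all hr k
    refine ⟨max k l, hG.mono ?_ hk⟩
    have := digits_eq (fun j hj => hl j hj (max k l) (le_max_right _ _)) k le_rfl
    rw [← this, length_initSeg]
    exact digits_prefix_of_le _ (le_max_left _ _)

/-! #### Pairing and functions with a known use -/

theorem pair (hF : Approx φ F) (hG : Approx ψ G) :
    Approx (fun σ n => (φ σ n).bind fun a => (ψ σ n).map fun b => Nat.pair a b)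
      (fun q => (F q).bind fun a => (G q).map fun b => pairB a b) where
  computable := by
    have h2 : Computable₂ fun (y : (List ℕ × ℕ) × ℕ) (b : ℕ) => Nat.pair y.2 b :=
      (Primrec₂.natPair.comp (Primrec.snd.comp Primrec.fst) Primrec.snd).to_comp
    have h3 : Computable fun y : (List ℕ × ℕ) × ℕ => ψ y.1.1 y.1.2 :=
      Computable.comp (f := fun x : List ℕ × ℕ => ψ x.1 x.2) hG.computable Computable.fst
    have h4 : Computable₂ fun (x : List ℕ × ℕ) (a : ℕ) =>
        (ψ x.1 x.2).map fun b => Nat.pair a b := Computable.option_map h3 h2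
    exact Computable.option_bind (f := fun x : List ℕ × ℕ => φ x.1 x.2) hF.computable h4
  mono h hm := by
    simp only [Option.bind_eq_some_iff, Option.map_eq_some_iff] at hm ⊢
    obtain ⟨a, ha, b, hb, e⟩ := hm
    exact ⟨a, hF.mono h ha, b, hG.mono h hb, e⟩
  reaches q s hs n := by
    simp only [Part.mem_bind_iff, Part.mem_map_iff] at hs
    obtain ⟨a, ha, b, hb, rfl⟩ := hs
    obtain ⟨k, hk⟩ := hF.reaches q a ha n
    obtain ⟨l, hl⟩ := hG.reaches q b hb n
    refine ⟨max k l, ?_⟩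
    rw [hF.mono (initSeg_prefix q (le_max_left k l)) hk,
      hG.mono (initSeg_prefix q (le_max_right k l)) hl]
    rfl

theorem of_use {g : ℕ → ℕ} {ψ : List ℕ → ℕ → ℕ} (hg : Computable g) (hψ : Computable₂ ψ) :
    Approx (fun σ n => if g n ≤ σ.length then some (ψ (σ.take (g n)) n) else none)
      (fun q => Part.some fun n => ψ (initSeg q (g n)) n) where
  computable := by
    have h0 : Computable fun x : List ℕ × ℕ => g x.2 := hg.comp Computable.snd
    have h1 : Computable fun x : List ℕ × ℕ => decide (g x.2 ≤ x.1.length) :=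
      (Primrec.nat_le.decide.to_comp).comp h0
        (Computable.list_length.comp Computable.fst)
    refine (Computable.cond h1 (Computable.option_some.comp (hψ.comp
      (Primrec.list_take.to_comp.comp h0 Computable.fst) Computable.snd))
      (Computable.const none)).of_eq fun x => ?_
    by_cases h : g x.2 ≤ x.1.length <;> simp [h]
  mono := by
    intro σ τ n m h hm
    have hl := h.length_le
    obtain ⟨t, rfl⟩ := h
    split_ifs at hm with h1
    rw [if_pos (h1.trans hl), List.take_append_of_le_length h1, hm]
  reaches q r hr n := by
    rw [Part.mem_some_iff] at hr
    subst hr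
    exact ⟨g n, by simp [take_initSeg]⟩

/-! #### The universal function -/

/-- Step of the search that the universal machine makes: `some 0` stands for an ongoing search,
`some (m + 1)` for the result `m` and `none` for a query beyond the known part of the program. -/
def searchStep (σ : List ℕ) (n k : ℕ) (s : Option ℕ) : Option ℕ :=
  s.bind fun v => Nat.casesOn v
    -- An answer of the program is itself `0` or `m + 1`, hence already has the form of the next
    -- search state.
    (σ.map fun a => a.unpair.1)[Nat.pair n (Encodable.encode ((σ.map fun a => a.unpair.2).take k))]?
    (fun w => some (w + 1))

/-- The first `k` steps of the search of the universal machine. -/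
def search (σ : List ℕ) (n k : ℕ) : Option ℕ :=
  Nat.rec (some 0) (fun k s => searchStep σ n k s) k

/-- The digit found in the search of the universal machine. -/
def univ (σ : List ℕ) (n : ℕ) : Option ℕ :=
  (search σ n (σ.length + 1)).bind fun v => Nat.casesOn v none some

theorem search_succ (σ : List ℕ) (n k : ℕ) :
    search σ n (k + 1) = searchStep σ n k (search σ n k) := rfl

/-- The bound on `k` ensures that `take` is never truncated by the end of `σ`; beyond it, `σ` and
`τ` could pose different queries. This is why `univ` stops after `σ.length + 1` steps. -/
theorem search_mono {σ τ : List ℕ} (h : σ <+: τ) (n : ℕ) :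
    ∀ k v, k ≤ σ.length + 1 → search σ n k = some v → search τ n k = some v := by
  intro k
  induction k with
  | zero => intro v _ h; exact h
  | succ k ih =>
    intro v hk hv
    rw [search_succ, searchStep, Option.bind_eq_some_iff] at hv
    obtain ⟨w, hw, hv⟩ := hv
    rw [search_succ, searchStep, ih w (by omega) hw]
    cases w with
    | succ w => exact hv
    | zero =>
      have e : (τ.map fun a => a.unpair.2).take k = (σ.map fun a => a.unpair.2).take k := by
        obtain ⟨t, rfl⟩ := h
        rw [List.map_append, List.take_append_of_le_length (by simp; omega)]
      simp only [Option.bind_some]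
      rw [e]
      exact getElem?_of_prefix (h.map _) hv

theorem search_stable {σ : List ℕ} {n k v : ℕ} (h : search σ n k = some (v + 1)) {l : ℕ}
    (hl : k ≤ l) : search σ n l = some (v + 1) := by
  induction hl with
  | refl => exact h
  | step _ ih => rw [search_succ, ih]; rfl

theorem univ_mono {σ τ : List ℕ} {n m : ℕ} (h : σ <+: τ) (hm : univ σ n = some m) :
    univ τ n = some m := by
  rw [univ, Option.bind_eq_some_iff] at hm
  obtain ⟨v, hv, hm⟩ := hm
  cases v with
  | zero => simp at hm
  | succ v =>
    have h1 := search_mono h n _ _ le_rfl hv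
    have h2 := h.length_le
    rw [univ, search_stable h1 (by omega : σ.length + 1 ≤ τ.length + 1)]
    exact hm

theorem computable_univ : Computable₂ univ := by
  have hs : Primrec fun x : (List ℕ × ℕ) × ℕ × Option ℕ =>
      searchStep x.1.1 x.1.2 x.2.1 x.2.2 := by
    have a : Primrec fun x : (List ℕ × ℕ) × ℕ × Option ℕ => x.1.1 :=
      Primrec.fst.comp Primrec.fst
    have b : Primrec fun x : (List ℕ × ℕ) × ℕ × Option ℕ => x.1.2 :=
      Primrec.snd.comp Primrec.fst
    have c : Primrec fun x : (List ℕ × ℕ) × ℕ × Option ℕ => x.2.1 :=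
      Primrec.fst.comp Primrec.snd
    have d : Primrec fun x : (List ℕ × ℕ) × ℕ × Option ℕ => x.2.2 :=
      Primrec.snd.comp Primrec.snd
    have e1 := Primrec.list_map (g := fun _ (m : ℕ) => m.unpair.1) a
      ((Primrec.fst.comp Primrec.unpair).comp Primrec.snd).to₂
    have e2 := Primrec.list_map (g := fun _ (m : ℕ) => m.unpair.2) a
      ((Primrec.snd.comp Primrec.unpair).comp Primrec.snd).to₂
    have f := Primrec.list_getElem?.comp e1 (Primrec₂.natPair.comp b
      (Primrec.encode.comp (Primrec.list_take.comp c e2)))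
    have g : Primrec₂ fun (_ : ((List ℕ × ℕ) × ℕ × Option ℕ) × ℕ) (w : ℕ) => some (w + 1) :=
      (Primrec.option_some.comp (Primrec.succ.comp Primrec.snd)).to₂
    exact Primrec.option_bind d (Primrec.nat_casesOn Primrec.snd (f.comp Primrec.fst) g).to₂
  have h1 : Primrec fun x : List ℕ × ℕ => search x.1 x.2 (x.1.length + 1) :=
    Primrec.nat_rec' (h := fun x y => searchStep x.1 x.2 y.1 y.2)
      (Primrec.succ.comp (Primrec.list_length.comp Primrec.fst)) (Primrec.const _) hs.to₂
  refine Primrec.to_comp ?_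
  exact Primrec.option_bind h1 (Primrec.nat_casesOn Primrec.snd (Primrec.const none)
    (Primrec.option_some.comp Primrec.snd).to₂).to₂

theorem universal : Approx univ (fun r => Φ (fstB r) (sndB r)) where
  computable := computable_univ
  mono := univ_mono
  reaches r s hs n := by
    obtain ⟨hd, rfl⟩ := hs
    set p := fstB r with hp
    set q := sndB r with hq
    set K := Nat.find (hd n) with hK
    -- `L` exceeds every position of the program that is consulted up to the successful step `K`;
    -- the summand `K` makes the needed prefixes of `q` available.
    set L := (Finset.range (K + 1)).sup (fun k => Nat.pair n (prefixCode q k) + 1) + K with hL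
    have hlt : ∀ k ≤ K, Nat.pair n (prefixCode q k) < L := fun k hk => by
      have := Finset.le_sup (f := fun k => Nat.pair n (prefixCode q k) + 1)
        (Finset.mem_range.2 (Nat.lt_succ_of_le hk))
      change Nat.pair n (prefixCode q k) + 1 ≤ (Finset.range (K + 1)).sup _ at this
      omega
    have e1 : (initSeg r L).map (fun a => a.unpair.1) = initSeg p L := by
      simp [initSeg, hp, fstB]
    have e2 : (initSeg r L).map (fun a => a.unpair.2) = initSeg q L := by
      simp [initSeg, hq, sndB]
    have hval : ∀ k ≤ K, searchStep (initSeg r L) n k (some 0) =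
        some (p (Nat.pair n (prefixCode q k))) := fun k hk => by
      simp only [searchStep, Option.bind_some]
      rw [e1, e2, take_initSeg q (by omega), ← prefixCode_eq]
      exact getElem?_initSeg p (hlt k hk)
    have hz : ∀ k ≤ K, search (initSeg r L) n k = some 0 := by
      intro k
      induction k with
      | zero => intro; rfl
      | succ k ih =>
        intro hk
        rw [search_succ, ih (by omega), hval k (by omega)]
        have := Nat.find_min (hd n) (show k < Nat.find (hd n) by omega)
        rw [not_not.1 this]
    have hne : p (Nat.pair n (prefixCode q K)) ≠ 0 := Nat.find_spec (hd n)
    have hfin : search (initSeg r L) n (K + 1) = some (p (Nat.pair n (prefixCode q K))) := by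
      rw [search_succ, hz K le_rfl, hval K le_rfl]
    obtain ⟨m, hm⟩ := Nat.exists_eq_succ_of_ne_zero hne
    rw [hm] at hfin
    refine ⟨L, ?_⟩
    rw [univ, length_initSeg, search_stable hfin (by omega : K + 1 ≤ L + 1)]
    change some m = some (p (Nat.pair n (prefixCode q K)) - 1)
    rw [hm]; rfl

theorem restrict (h : Approx φ G) (hFG : ∀ q r, r ∈ F q → r ∈ G q) : Approx φ F :=
  ⟨h.computable, h.mono, fun q r hr => h.reaches q r (hFG q r hr)⟩

theorem const {c : Baire} (hc : Computable c) :
    Approx (fun _ n => some (c n)) (fun _ => Part.some c) where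
  computable := (Computable.option_some.comp (hc.comp Computable.snd)).to₂
  mono _ h := h
  reaches q r hr n := by
    rw [Part.mem_some_iff] at hr
    subst hr
    exact ⟨0, rfl⟩

theorem ident : Approx (fun σ n => σ[n]?) (fun q => Part.some q) where
  computable := Computable.list_getElem?
  mono h hm := getElem?_of_prefix h hm
  reaches q r hr n := by
    rw [Part.mem_some_iff] at hr
    subst hr
    exact ⟨n + 1, getElem?_initSeg r (Nat.lt_succ_self n)⟩

end Approx

theorem fstB_pairB (p q : Baire) : fstB (pairB p q) = p := by
  funext n; simp [fstB, pairB]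

theorem sndB_pairB (p q : Baire) : sndB (pairB p q) = q := by
  funext n; simp [sndB, pairB]

theorem pairB_eta (r : Baire) : pairB (fstB r) (sndB r) = r := by
  funext n; simp [fstB, sndB, pairB]

attribute [simp] fstB_pairB sndB_pairB pairB_eta

/-- `F` is a restriction of `q ↦ ⟨p, q⟩` followed by the universal function. With
`Approx.computableFun`, computability becomes the existence of an approximation. -/
theorem ComputableFun.exists_approx {F : Baire →. Baire} (h : ComputableFun F) :
    ∃ φ, Approx φ F := by
  obtain ⟨p, hp, hF⟩ := h
  refine ⟨_, (((Approx.const hp).pair Approx.ident).comp Approx.universal).restrict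
    fun q r hr => ?_⟩
  simpa using hF q r hr

end Weihrauch

namespace Weihrauch

/-! ### Closure properties of the computable functions -/

/-- A total function on Baire space is computable. -/
def ComputableTot (f : Baire → Baire) : Prop := ComputableFun fun q => Part.some (f q)

namespace ComputableFun

variable {F G : Baire →. Baire}

theorem of_eq (hF : ComputableFun F) (h : ∀ q, F q = G q) : ComputableFun G :=
  (funext h : F = G) ▸ hF

theorem comp' (hF : ComputableFun F) (hG : ComputableFun G) :
    ComputableFun fun q => (F q).bind G := by
  obtain ⟨φ, hφ⟩ := hF.exists_approx
  obtain ⟨ψ, hψ⟩ := hG.exists_approx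
  exact (hφ.comp hψ).computableFun

theorem comp_tot {f : Baire → Baire} (hG : ComputableFun G) (hf : ComputableTot f) :
    ComputableFun fun q => G (f q) :=
  (comp' hf hG).of_eq fun _ => Part.bind_some _ _

/-- The input is carried along as `⟨q, F q⟩`. Under iteration the context becomes a nested pair, and
the chains of `.fst` and `.snd` in later proofs address the variables bound so far. -/
theorem bind {F : Baire → Part Baire} {G : Baire → Baire → Part Baire} (hF : ComputableFun F)
    (hG : ComputableFun fun z => G (fstB z) (sndB z)) :
    ComputableFun fun q => (F q).bind (G q) := by
  obtain ⟨φ, hφ⟩ := hF.exists_approx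
  obtain ⟨ψ, hψ⟩ := hG.exists_approx
  have := ((Approx.ident.pair hφ).comp hψ).computableFun
  simpa [Part.bind_assoc, Part.bind_map] using this

theorem app {f g : Baire → Baire} (hf : ComputableTot f) (hg : ComputableTot g) :
    ComputableFun fun q => Φ (f q) (g q) := by
  obtain ⟨φ, hφ⟩ := exists_approx hf
  obtain ⟨ψ, hψ⟩ := exists_approx hg
  simpa using ((hφ.pair hψ).comp Approx.universal).computableFun

/-- The parametrization theorem for the universal function. -/
theorem smn (hF : ComputableFun F) :
    ∃ s : Baire → Baire, ComputableTot s ∧ ∀ p q r, r ∈ F (pairB p q) → r ∈ Φ (s p) q := by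
  obtain ⟨φ, hφ⟩ := hF.exists_approx
  -- A query `m` contains a prefix `σ` of `q`, which `D` recovers. `Z` zips it with a prefix of `p`
  -- into a prefix of `⟨p, q⟩`. So digit `m` of the new program needs only `g m`, the length of `σ`,
  -- many digits of `p`.
  let D : ℕ → Option (List ℕ) := fun m => Encodable.decode m.unpair.2
  let Z : List ℕ → List ℕ → List ℕ := fun π σ =>
    (List.range σ.length).map fun j => Nat.pair (π.getD j 0) (σ.getD j 0)
  let g : ℕ → ℕ := fun m => ((D m).map List.length).getD 0
  let ψ : List ℕ → ℕ → ℕ := fun π m =>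
    (((D m).bind fun σ => φ (Z π σ) m.unpair.1).map Nat.succ).getD 0
  have hD : Primrec D := Primrec.decode.comp (Primrec.snd.comp Primrec.unpair)
  have hg : Computable g := by
    refine Primrec.to_comp (Primrec.option_getD.comp (Primrec.option_map hD ?_) (Primrec.const 0))
    exact (Primrec.list_length.comp Primrec.snd).to₂
  have hZ : Primrec₂ Z := by
    refine Primrec.list_map (f := fun x : List ℕ × List ℕ => List.range x.2.length)
      (g := fun x j => Nat.pair (x.1.getD j 0) (x.2.getD j 0))
      (Primrec.list_range.comp (Primrec.list_length.comp Primrec.snd)) ?_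
    exact (Primrec₂.natPair.comp
      ((Primrec.list_getD 0).comp (Primrec.fst.comp Primrec.fst) Primrec.snd)
      ((Primrec.list_getD 0).comp (Primrec.snd.comp Primrec.fst) Primrec.snd)).to₂
  have hψ : Computable₂ ψ := by
    have h1 : Computable fun y : (List ℕ × ℕ) × List ℕ => Z y.1.1 y.2 :=
      (hZ.comp (Primrec.fst.comp Primrec.fst) Primrec.snd).to_comp
    have h2 : Computable fun y : (List ℕ × ℕ) × List ℕ => y.1.2.unpair.1 :=
      (Primrec.fst.comp (Primrec.unpair.comp (Primrec.snd.comp Primrec.fst))).to_comp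
    have h3 : Computable₂ fun (x : List ℕ × ℕ) (σ : List ℕ) => φ (Z x.1 σ) x.2.unpair.1 :=
      Computable₂.comp hφ.computable h1 h2
    have h4 : Computable fun x : List ℕ × ℕ => D x.2 := hD.to_comp.comp Computable.snd
    exact Computable.option_getD (Computable.option_map (Computable.option_bind h4 h3)
      (Computable.succ.comp Computable.snd).to₂) (Computable.const 0)
  refine ⟨_, (Approx.of_use hg hψ).computableFun, fun p q r hr => ?_⟩
  have key : ∀ n k, ψ (initSeg p (g (Nat.pair n (prefixCode q k)))) (Nat.pair n (prefixCode q k)) =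
      ((φ (initSeg (pairB p q) k) n).map Nat.succ).getD 0 := by
    intro n k
    have e1 : D (Nat.pair n (prefixCode q k)) = some (initSeg q k) := by
      simp [D, prefixCode_eq]
    have e2 : g (Nat.pair n (prefixCode q k)) = k := by simp [g, e1]
    have e3 : Z (initSeg p k) (initSeg q k) = initSeg (pairB p q) k := by
      simp only [Z, length_initSeg]
      refine List.map_congr_left fun j hj => ?_
      have hj := List.mem_range.1 hj
      simp [List.getD_eq_getElem?_getD, hj, pairB]
    rw [e2]
    simp [ψ, e1, e3]
  exact Approx.mem_Φ_of_code key (hφ.reaches _ _ hr) fun _ _ _ => hφ.eq_of_mem hr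

theorem smn₂ {G : Baire → Baire → Part Baire}
    (hG : ComputableFun fun z => G (fstB z) (sndB z)) :
    ∃ s : Baire → Baire, ComputableTot s ∧ ∀ p q r, r ∈ G p q → r ∈ Φ (s p) q := by
  obtain ⟨s, hs, h⟩ := hG.smn
  exact ⟨s, hs, fun p q r hr => h p q r (by simpa using hr)⟩

theorem exists_use (hF : ComputableFun F) {q r : Baire} (hr : r ∈ F q) (n : ℕ) :
    ∃ k, ∀ q' r', r' ∈ F q' → initSeg q' k = initSeg q k → r' n = r n := by
  obtain ⟨φ, hφ⟩ := hF.exists_approx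
  obtain ⟨k, hk⟩ := hφ.reaches q r hr n
  exact ⟨k, fun q' r' hr' h => (hφ.eq_of_mem hr' (h ▸ hk)).symm⟩

theorem continuous {X : Type*} [TopologicalSpace X]
    {F : Baire →. Baire} (hF : ComputableFun F) {f g : X → Baire} (hf : Continuous f)
    (hg : ∀ x, g x ∈ F (f x)) : Continuous g := by
  refine continuous_pi fun n => IsLocallyConstant.continuous
    ((IsLocallyConstant.iff_eventually_eq _).2 fun x => ?_)
  obtain ⟨k, hk⟩ := hF.exists_use (hg x) n
  have : ∀ᶠ y in 𝓝 x, ∀ j ∈ Finset.range k, f y j = f x j := by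
    rw [Filter.eventually_all_finset]
    exact fun j _ => ((continuous_apply j).comp hf).continuousAt.eventually
      (p := fun v => v = f x j) (by simp [nhds_discrete])
  filter_upwards [this] with y hy
  exact hk _ _ (hg y) (initSeg_congr fun j hj => hy j (Finset.mem_range.2 hj))

/-- The approximation is run along the computable prefixes of `q` until it answers; membership in
the domain guarantees that the search ends. -/
theorem computable_of_mem (hF : ComputableFun F) {q r : Baire} (hq : Computable q)
    (hr : r ∈ F q) : Computable r := by
  obtain ⟨φ, hφ⟩ := hF.exists_approx
  have hs : Computable (initSeg q) := by
    have h : Computable₂ fun (_ : ℕ) (y : ℕ × List ℕ) => y.2 ++ [q y.1] :=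
      Computable.list_concat.comp (Computable.snd.comp Computable.snd)
        (hq.comp (Computable.fst.comp Computable.snd))
    refine (Computable.nat_rec Computable.id (Computable.const []) h).of_eq fun k => ?_
    induction k with
    | zero => rfl
    | succ k ih => rw [initSeg_succ, ← ih]; rfl
  have h2 : Computable₂ fun n k => φ (initSeg q k) n :=
    Computable₂.comp hφ.computable (hs.comp Computable.snd) Computable.fst
  refine (Partrec.rfindOpt h2).of_eq_tot fun n => ?_
  have hd : (Nat.rfindOpt fun k => φ (initSeg q k) n).Dom :=
    Nat.rfindOpt_dom.2 (let ⟨k, hk⟩ := hφ.reaches q r hr n; ⟨k, r n, hk⟩)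
  obtain ⟨k, hk⟩ := Nat.rfindOpt_spec (Part.get_mem hd)
  rw [← hφ.eq_of_mem hr hk]
  exact Part.get_mem hd

end ComputableFun

namespace ComputableTot

theorem const {c : Baire} (hc : Computable c) : ComputableTot fun _ => c :=
  (Approx.const hc).computableFun

theorem zero : ComputableTot fun _ _ => 0 := const (Computable.const 0)

theorem id : ComputableTot fun q => q := Approx.ident.computableFun

theorem comp {f g : Baire → Baire} (hf : ComputableTot f) (hg : ComputableTot g) :
    ComputableTot fun q => f (g q) := ComputableFun.comp_tot (G := fun q => Part.some (f q)) hf hg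

/-- The `n`-th digit of the output is computed from the first `k n` digits of the input. -/
theorem of_use {k : ℕ → ℕ} {ψ : List ℕ → ℕ → ℕ} (hk : Computable k) (hψ : Computable₂ ψ) :
    ComputableTot fun q n => ψ (initSeg q (k n)) n :=
  (Approx.of_use hk hψ).computableFun

theorem digitwise {f : ℕ → ℕ} (hf : Primrec f) : ComputableTot fun q n => f (q n) := by
  have h : Primrec₂ fun (σ : List ℕ) (n : ℕ) => f (σ.getD n 0) :=
    hf.comp₂ (Primrec.list_getD 0)
  have := of_use Computable.succ h.to_comp
  refine cast ?_ this
  congr 1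
  funext q n
  simp [List.getD_eq_getElem?_getD]

theorem fst {f : Baire → Baire} (hf : ComputableTot f) : ComputableTot fun q => fstB (f q) :=
  comp (f := fstB) (digitwise (Primrec.fst.comp Primrec.unpair)) hf

theorem snd {f : Baire → Baire} (hf : ComputableTot f) : ComputableTot fun q => sndB (f q) :=
  comp (f := sndB) (digitwise (Primrec.snd.comp Primrec.unpair)) hf

theorem pair {f g : Baire → Baire} (hf : ComputableTot f) (hg : ComputableTot g) :
    ComputableTot fun q => pairB (f q) (g q) := by
  obtain ⟨φ, hφ⟩ := ComputableFun.exists_approx hf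
  obtain ⟨ψ, hψ⟩ := ComputableFun.exists_approx hg
  exact (hφ.pair hψ).computableFun.of_eq fun q => by simp

end ComputableTot

theorem ComputableFun.pair {f g : Baire → Baire} (hf : ComputableTot f) (hg : ComputableTot g) :
    ComputableFun fun q => Part.some (pairB (f q) (g q)) :=
  ComputableTot.pair hf hg

/-- Names of constant functions can be computed from the value. -/
theorem exists_const_code :
    ∃ s : Baire → Baire, ComputableTot s ∧ ∀ c q, c ∈ Φ (s c) q := by
  obtain ⟨s, hs, h⟩ := ComputableFun.smn (ComputableTot.fst ComputableTot.id)
  exact ⟨s, hs, fun c q => h c q c (by simp)⟩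

end Weihrauch

namespace Weihrauch

/-! ### Problems as relations on Baire space -/

/-- A problem on names: `R p r` means that `p` is a name of an instance
and `r` is a name of one of its solutions. -/
abbrev NameRel := Baire → Baire → Prop

namespace NameRel

/-- Weihrauch reducibility on the level of names. -/
def LE (R S : NameRel) : Prop :=
  ∃ K H : Baire →. Baire, ComputableFun K ∧ ComputableFun H ∧ ∀ p c, R p c →
    ∃ a ∈ H p, (∃ b, S a b) ∧ ∀ b, S a b → ∃ r ∈ K (pairB p b), R p r

/-- The product on the level of names. -/
def times (R S : NameRel) : NameRel := fun p r => R (fstB p) (fstB r) ∧ S (sndB p) (sndB r)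

/-- The compositional product on the level of names. -/
def star (R S : NameRel) : NameRel := fun a s =>
  (∀ y r, S (sndB a) y → ∃ t ∈ Φ (fstB a) (pairB y r), ∃ v, R (sndB t) v) ∧
    ∃ y r, S (sndB a) y ∧ ∃ t ∈ Φ (fstB a) (pairB y r), fstB s = fstB t ∧ R (sndB t) (sndB s)

/-- The implication on the level of names. -/
def impl (S R : NameRel) : NameRel := fun u a =>
  (∃ y, S (sndB a) y) ∧ ∀ y r, S (sndB a) y → ∃ t ∈ Φ (fstB a) (pairB y r), R u t

variable {R R' S S' T : NameRel}

theorem star_dom {a : Baire} : (∃ s, star R S a s) ↔ (∃ y, S (sndB a) y) ∧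
    ∀ y r, S (sndB a) y → ∃ t ∈ Φ (fstB a) (pairB y r), ∃ v, R (sndB t) v := by
  constructor
  · rintro ⟨s, h, y, r, hy, -⟩
    exact ⟨⟨y, hy⟩, h⟩
  · rintro ⟨⟨y, hy⟩, h⟩
    obtain ⟨t, ht, v, hv⟩ := h y y hy
    exact ⟨pairB (fstB t) v, h, y, y, hy, t, ht, by simpa using hv⟩

/-- A constant function whose value solves `u` is always an admissible `H`, so only an instance of
`S` is needed to go with it. -/
theorem impl_dom {u : Baire} :
    (∃ a, impl S R u a) ↔ (∃ x y, S x y) ∧ ∃ v, R u v := by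
  constructor
  · rintro ⟨a, ⟨y, hy⟩, h⟩
    obtain ⟨t, -, ht⟩ := h y y hy
    exact ⟨⟨_, y, hy⟩, t, ht⟩
  · rintro ⟨⟨x, y, hy⟩, v, hv⟩
    obtain ⟨s, -, hs⟩ := exists_const_code
    exact ⟨pairB (s v) x, ⟨y, by simpa using hy⟩, fun _ _ _ => ⟨v, by simpa using hs v _, hv⟩⟩

theorem LE.of_total {k h : Baire → Baire} (hk : ComputableTot k) (hh : ComputableTot h)
    (h1 : ∀ p c, R p c → ∃ b, S (h p) b)
    (h2 : ∀ p b, (∃ c, R p c) → S (h p) b → R p (k (pairB p b))) : LE R S :=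
  ⟨_, _, hk, hh, fun p c hc => ⟨h p, Part.mem_some _, h1 p c hc, fun b hb =>
    ⟨_, Part.mem_some _, h2 p b ⟨c, hc⟩ hb⟩⟩⟩

theorem LE.refl (R : NameRel) : LE R R :=
  .of_total (ComputableTot.snd .id) .id (fun _ c hc => ⟨c, hc⟩) fun _ _ _ hb => by simpa using hb

theorem LE.of_empty (h : ∀ p r, ¬ R p r) : LE R S :=
  ⟨_, _, ComputableTot.id, ComputableTot.id, fun p c hc => (h p c hc).elim⟩

theorem LE.trans (h1 : LE R S) (h2 : LE S T) : LE R T := by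
  obtain ⟨K, H, hK, hH, h⟩ := h1
  obtain ⟨K', H', hK', hH', h'⟩ := h2
  refine ⟨fun z => (H (fstB z)).bind fun a => (K' (pairB a (sndB z))).bind fun b =>
    K (pairB (fstB z) b), fun p => (H p).bind H', ?_, hH.comp' hH', fun p c hc => ?_⟩
  · refine (hH.comp_tot (.fst .id)).bind (.bind (hK'.comp_tot (.pair (.snd .id)
      (.snd (.fst .id)))) (hK.comp_tot (.pair (.fst (.fst (.fst .id))) (.snd .id))))
  · obtain ⟨a, ha, ⟨b, hb⟩, hab⟩ := h p c hc
    obtain ⟨a', ha', hb', hab'⟩ := h' a b hb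
    refine ⟨a', Part.mem_bind ha ha', hb', fun b' hb' => ?_⟩
    obtain ⟨r, hr, hr'⟩ := hab' b' hb'
    obtain ⟨s, hs, hs'⟩ := hab r hr'
    exact ⟨s, Part.mem_bind (by simpa using ha) (Part.mem_bind (by simpa using hr)
      (by simpa using hs)), hs'⟩

/-! #### The product -/

theorem times_mono (h : LE R R') (h' : LE S S') : LE (times R S) (times R' S') := by
  obtain ⟨K, H, hK, hH, h⟩ := h
  obtain ⟨K', H', hK', hH', h'⟩ := h'
  refine ⟨fun z => (K (pairB (fstB (fstB z)) (fstB (sndB z)))).bind fun a =>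
      (K' (pairB (sndB (fstB z)) (sndB (sndB z)))).bind fun b => Part.some (pairB a b),
    fun p => (H (fstB p)).bind fun a => (H' (sndB p)).bind fun b => Part.some (pairB a b),
    ?_, ?_, fun p c hc => ?_⟩
  · exact (hK.comp_tot (.pair (.fst (.fst .id)) (.fst (.snd .id)))).bind
      ((hK'.comp_tot (.pair (.snd (.fst (.fst .id))) (.snd (.snd (.fst .id))))).bind
        (.pair (.snd (.fst .id)) (.snd .id)))
  · exact (hH.comp_tot (.fst .id)).bind ((hH'.comp_tot (.snd (.fst .id))).bind
        (.pair (.snd (.fst .id)) (.snd .id)))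
  · obtain ⟨a, ha, ⟨b, hb⟩, hab⟩ := h _ _ hc.1
    obtain ⟨a', ha', ⟨b', hb'⟩, hab'⟩ := h' _ _ hc.2
    refine ⟨pairB a a', Part.mem_bind ha (Part.mem_bind ha' (Part.mem_some _)),
      ⟨pairB b b', by simpa [times] using ⟨hb, hb'⟩⟩, fun e he => ?_⟩
    simp only [times, fstB_pairB, sndB_pairB] at he
    obtain ⟨r, hr, h1⟩ := hab _ he.1
    obtain ⟨s, hs, h2⟩ := hab' _ he.2
    exact ⟨pairB r s, Part.mem_bind (by simpa using hr) (Part.mem_bind (by simpa using hs)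
      (Part.mem_some _)), by simpa [times] using ⟨h1, h2⟩⟩

theorem times_assoc_le : LE (times (times R S) T) (times R (times S T)) := by
  refine .of_total (h := fun p => pairB (fstB (fstB p)) (pairB (sndB (fstB p)) (sndB p)))
    (k := fun z => pairB (pairB (fstB (sndB z)) (fstB (sndB (sndB z)))) (sndB (sndB (sndB z))))
    ?_ ?_ ?_ ?_
  · exact .pair (.pair (.fst (.snd .id)) (.fst (.snd (.snd .id)))) (.snd (.snd (.snd .id)))
  · exact .pair (.fst (.fst .id)) (.pair (.snd (.fst .id)) (.snd .id))
  · rintro p c ⟨⟨h1, h2⟩, h3⟩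
    exact ⟨pairB (fstB (fstB c)) (pairB (sndB (fstB c)) (sndB c)),
      by simpa [times] using ⟨h1, h2, h3⟩⟩
  · rintro p b - hb
    simpa [times, and_assoc] using hb

theorem times_assoc_ge : LE (times R (times S T)) (times (times R S) T) := by
  refine .of_total (h := fun p => pairB (pairB (fstB p) (fstB (sndB p))) (sndB (sndB p)))
    (k := fun z => pairB (fstB (fstB (sndB z))) (pairB (sndB (fstB (sndB z))) (sndB (sndB z))))
    ?_ ?_ ?_ ?_
  · exact .pair (.fst (.fst (.snd .id))) (.pair (.snd (.fst (.snd .id))) (.snd (.snd .id)))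
  · exact .pair (.pair (.fst .id) (.fst (.snd .id))) (.snd (.snd .id))
  · rintro p c ⟨h1, h2, h3⟩
    exact ⟨pairB (pairB (fstB c) (fstB (sndB c))) (sndB (sndB c)),
      by simpa [times] using ⟨⟨h1, h2⟩, h3⟩⟩
  · rintro p b - hb
    simpa [times, and_assoc] using hb

theorem times_comm_le : LE (times R S) (times S R) := by
  refine .of_total (h := fun p => pairB (sndB p) (fstB p))
    (k := fun z => pairB (sndB (sndB z)) (fstB (sndB z))) ?_ ?_ ?_ ?_
  · exact .pair (.snd (.snd .id)) (.fst (.snd .id))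
  · exact .pair (.snd .id) (.fst .id)
  · rintro p c ⟨h1, h2⟩
    exact ⟨pairB (sndB c) (fstB c), by simpa [times] using ⟨h2, h1⟩⟩
  · rintro p b - hb
    simpa [times, and_comm] using hb

/-! #### The compositional product -/

/-- The new code converts an answer of `S'` by `K'`, runs the old code to get `t`, and translates
the `R`-instance in `t` by `H`. As `K` will need that `R`-instance again, all of `t` is stored in
the Baire component of the output. -/
theorem star_mono (h : LE R R') (h' : LE S S') : LE (star R S) (star R' S') := by
  obtain ⟨K, H, hK, hH, h⟩ := h
  obtain ⟨K', H', hK', hH', h'⟩ := h'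
  obtain ⟨s, hs, hsG⟩ := ComputableFun.smn₂ (G := fun a q =>
    (K' (pairB (sndB a) (fstB q))).bind fun y => (Φ (fstB a) (pairB y (sndB q))).bind fun t =>
      (H (sndB t)).bind fun u => Part.some (pairB t u))
    ((hK'.comp_tot (.pair (.snd (.fst .id)) (.fst (.snd .id)))).bind
      (.bind (.app (.fst (.fst (.fst .id))) (.pair (.snd .id) (.snd (.snd (.fst .id)))))
        ((hH.comp_tot (.snd (.snd .id))).bind (.pair (.snd (.fst .id)) (.snd .id)))))
  refine ⟨fun z => (K (pairB (sndB (fstB (sndB z))) (sndB (sndB z)))).bind fun v =>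
      Part.some (pairB (fstB (fstB (sndB z))) v),
    fun a => (H' (sndB a)).bind fun x => Part.some (pairB (s a) x), ?_, ?_, fun a c hc => ?_⟩
  · exact (hK.comp_tot (.pair (.snd (.fst (.snd .id))) (.snd (.snd .id)))).bind
      (.pair (.fst (.fst (.snd (.fst .id)))) (.snd .id))
  · exact (hH'.comp_tot (.snd .id)).bind (.pair (hs.comp (.fst .id)) (.snd .id))
  · obtain ⟨⟨y₀, hy₀⟩, hd⟩ := star_dom.1 ⟨c, hc⟩
    obtain ⟨x, hx, hx', hxy⟩ := h' _ _ hy₀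
    have key : ∀ y r, S' x y → ∃ y' t u, S (sndB a) y' ∧ t ∈ Φ (fstB a) (pairB y' r) ∧
        u ∈ H (sndB t) ∧ pairB t u ∈ Φ (s a) (pairB y r) ∧ (∃ v, R' u v) ∧
        ∀ v, R' u v → ∃ w ∈ K (pairB (sndB t) v), R (sndB t) w := fun y r hy => by
      obtain ⟨y', hy', hS⟩ := hxy y hy
      obtain ⟨t, ht, v, hv⟩ := hd y' r hS
      obtain ⟨u, hu, hu', huv⟩ := h _ _ hv
      exact ⟨y', t, u, hS, ht, hu, hsG _ _ _ (Part.mem_bind (by simpa using hy')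
        (Part.mem_bind (by simpa using ht) (Part.mem_bind hu (Part.mem_some _)))), hu', huv⟩
    refine ⟨pairB (s a) x, Part.mem_bind hx (Part.mem_some _), star_dom.2 ⟨by simpa using hx', ?_⟩,
      ?_⟩
    · intro y r hy
      simp only [sndB_pairB, fstB_pairB] at hy ⊢
      obtain ⟨y', t, u, -, -, -, h4, h5, -⟩ := key y r hy
      exact ⟨_, h4, by simpa using h5⟩
    · rintro b ⟨-, y, r, hy, t', ht', h1, h2⟩
      simp only [sndB_pairB, fstB_pairB] at hy ht'
      obtain ⟨y', t, u, k1, k2, -, k4, -, k6⟩ := key y r hy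
      obtain rfl := Part.mem_unique ht' k4
      simp only [sndB_pairB, fstB_pairB] at h1 h2
      obtain ⟨w, hw, hR⟩ := k6 _ h2
      refine ⟨pairB (fstB t) w, Part.mem_bind (by simpa [h1] using hw) (by simp [h1]), hd, y', r,
        k1, t, k2, by simpa using hR⟩

/-- The given code outputs `⟨z, ⟨h', u⟩⟩` with `h'` the code to be used after `S` answers `u`. `s₁`
regroups this as `⟨⟨z, h'⟩, u⟩`, so that `z` and `h'` bypass `S`; `s₂` then runs `h'` on the answer
and lets `z` bypass `R`. -/
theorem star_assoc_le : LE (star (star R S) T) (star R (star S T)) := by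
  obtain ⟨s₁, hs₁, hs₁G⟩ := ComputableFun.smn₂ (G := fun h q => (Φ h q).bind fun t =>
      Part.some (pairB (pairB (fstB t) (fstB (sndB t))) (sndB (sndB t))))
    (.bind (.app (.fst .id) (.snd .id)) (.pair (.pair (.fst (.snd .id))
      (.fst (.snd (.snd .id)))) (.snd (.snd (.snd .id)))))
  obtain ⟨s₂, hs₂, hs₂G⟩ := ComputableFun.smn₂ (G := fun _ q =>
      (Φ (sndB (fstB (fstB q))) (pairB (sndB (fstB q)) (sndB q))).bind fun t =>
        Part.some (pairB (pairB (fstB (fstB (fstB q))) (fstB t)) (sndB t)))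
    (.bind (.app (.snd (.fst (.fst (.snd .id)))) (.pair (.snd (.fst (.snd .id)))
      (.snd (.snd .id)))) (.pair (.pair (.fst (.fst (.fst (.snd (.fst .id))))) (.fst (.snd .id)))
        (.snd (.snd .id))))
  have main : ∀ a, (∃ c, star (star R S) T a c) →
      (∃ b, star R (star S T) (pairB (s₂ a) (pairB (s₁ (fstB a)) (sndB a))) b) ∧
      ∀ b, star R (star S T) (pairB (s₂ a) (pairB (s₁ (fstB a)) (sndB a))) b →
        star (star R S) T a
          (pairB (fstB (fstB b)) (pairB (sndB (fstB b)) (sndB b))) := by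
    intro a hc
    obtain ⟨⟨y₀, hy₀⟩, hd⟩ := star_dom.1 hc
    have k1 : ∀ y r, T (sndB a) y → ∃ t ∈ Φ (fstB a) (pairB y r),
        pairB (pairB (fstB t) (fstB (sndB t))) (sndB (sndB t)) ∈ Φ (s₁ (fstB a)) (pairB y r) ∧
        (∃ w, S (sndB (sndB t)) w) ∧ ∀ w r, S (sndB (sndB t)) w →
          ∃ t' ∈ Φ (fstB (sndB t)) (pairB w r), ∃ v, R (sndB t') v := fun y r hy => by
      obtain ⟨t, ht, hv⟩ := hd y r hy
      exact ⟨t, ht, hs₁G _ _ _ (Part.mem_bind ht (Part.mem_some _)), star_dom.1 hv⟩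
    have k2 : ∀ w, star S T (pairB (s₁ (fstB a)) (sndB a)) w → ∃ y r t, T (sndB a) y ∧
        t ∈ Φ (fstB a) (pairB y r) ∧ fstB w = pairB (fstB t) (fstB (sndB t)) ∧
        S (sndB (sndB t)) (sndB w) ∧ ∀ r', ∃ t' ∈ Φ (fstB (sndB t)) (pairB (sndB w) r'),
          pairB (pairB (fstB t) (fstB t')) (sndB t') ∈ Φ (s₂ a) (pairB w r') ∧
            ∃ v, R (sndB t') v := by
      rintro w ⟨-, y, r, hy, t', ht', h1, h2⟩
      simp only [sndB_pairB, fstB_pairB] at hy ht' h1 h2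
      obtain ⟨t, ht, m1, -, m2⟩ := k1 y r hy
      obtain rfl := Part.mem_unique ht' m1
      simp only [sndB_pairB, fstB_pairB] at h1 h2
      refine ⟨y, r, t, hy, ht, h1, h2, fun r' => ?_⟩
      obtain ⟨t', ht', hv⟩ := m2 _ r' h2
      exact ⟨t', ht', hs₂G _ _ _ (Part.mem_bind (by simpa [h1] using ht') (by simp [h1])), hv⟩
    constructor
    · refine star_dom.2 ⟨?_, ?_⟩
      · simp only [sndB_pairB]
        refine star_dom.2 ⟨⟨y₀, by simpa using hy₀⟩, fun y r hy => ?_⟩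
        simp only [sndB_pairB, fstB_pairB] at hy ⊢
        obtain ⟨t, -, m1, m2, -⟩ := k1 y r hy
        exact ⟨_, m1, by simpa using m2⟩
      · intro w r' hw
        simp only [sndB_pairB, fstB_pairB] at hw ⊢
        obtain ⟨y, r, t, -, -, -, -, h⟩ := k2 w hw
        obtain ⟨t', -, ht', hv⟩ := h r'
        exact ⟨_, ht', by simpa using hv⟩
    · rintro b ⟨-, w, r', hw, e, he, h1, h2⟩
      simp only [sndB_pairB, fstB_pairB] at hw he
      obtain ⟨y, r, t, m1, m2, m3, m4, h⟩ := k2 w hw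
      obtain ⟨t', ht', he', -⟩ := h r'
      obtain rfl := Part.mem_unique he he'
      simp only [sndB_pairB, fstB_pairB] at h1 h2
      obtain ⟨u, hu, -, -, hS⟩ := k1 y r m1
      obtain rfl := Part.mem_unique hu m2
      refine ⟨hd, y, r, m1, u, m2, by simp [h1], ?_⟩
      simp only [sndB_pairB]
      exact ⟨hS, sndB w, r', m4, t', ht', by simp [h1], by simpa using h2⟩
  refine .of_total (h := fun a => pairB (s₂ a) (pairB (s₁ (fstB a)) (sndB a)))
    (k := fun z => pairB (fstB (fstB (sndB z))) (pairB (sndB (fstB (sndB z))) (sndB (sndB z))))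
    ?_ ?_ (fun a c hc => (main a ⟨c, hc⟩).1) (fun a b hc hb => ?_)
  · exact .pair (.fst (.fst (.snd .id))) (.pair (.snd (.fst (.snd .id))) (.snd (.snd .id)))
  · exact .pair hs₂ (.pair (hs₁.comp (.fst .id)) (.snd .id))
  · simpa using (main a hc).2 b hb

/-- This is partial application: once the inner code has output `⟨z, u⟩`, `s₁` freezes `z` into the
outer code, giving a code that only awaits the answer of `S` to `u`. -/
theorem star_assoc_ge : LE (star R (star S T)) (star (star R S) T) := by
  obtain ⟨s₁, hs₁, hs₁G⟩ := ComputableFun.smn₂ (G := fun c q =>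
      Φ (fstB c) (pairB (pairB (sndB c) (fstB q)) (sndB q)))
    (.app (.fst (.fst .id)) (.pair (.pair (.snd (.fst .id)) (.fst (.snd .id))) (.snd (.snd .id))))
  obtain ⟨s₂, hs₂, hs₂G⟩ := ComputableFun.smn₂ (G := fun a q =>
      (Φ (fstB (sndB a)) q).bind fun t =>
        Part.some (pairB (fstB t) (pairB (s₁ (pairB (fstB a) (fstB t))) (sndB t))))
    (.bind (.app (.fst (.snd (.fst .id))) (.snd .id)) (.pair (.fst (.snd .id)) (.pair
      (hs₁.comp (.pair (.fst (.fst (.fst .id))) (.fst (.snd .id)))) (.snd (.snd .id)))))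
  have main : ∀ a, (∃ c, star R (star S T) a c) →
      (∃ b, star (star R S) T (pairB (s₂ a) (sndB (sndB a))) b) ∧
      ∀ b, star (star R S) T (pairB (s₂ a) (sndB (sndB a))) b →
        star R (star S T) a (sndB b) := by
    intro a hc
    obtain ⟨hST, hd⟩ := star_dom.1 hc
    obtain ⟨hT, hd'⟩ := star_dom.1 hST
    have k1 : ∀ y r, T (sndB (sndB a)) y → ∃ t ∈ Φ (fstB (sndB a)) (pairB y r),
        pairB (fstB t) (pairB (s₁ (pairB (fstB a) (fstB t))) (sndB t)) ∈ Φ (s₂ a) (pairB y r) ∧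
        (∃ w, S (sndB t) w) ∧ ∀ w, S (sndB t) w → star S T (sndB a) (pairB (fstB t) w) ∧
          ∀ r', ∃ t' ∈ Φ (fstB a) (pairB (pairB (fstB t) w) r'),
            t' ∈ Φ (s₁ (pairB (fstB a) (fstB t))) (pairB w r') ∧ ∃ v, R (sndB t') v :=
        fun y r hy => by
      obtain ⟨t, ht, hv⟩ := hd' y r hy
      refine ⟨t, ht, hs₂G _ _ _ (Part.mem_bind ht (Part.mem_some _)), hv, fun w hw => ?_⟩
      have hst : star S T (sndB a) (pairB (fstB t) w) :=
        ⟨hd', y, r, hy, t, ht, by simpa using hw⟩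
      refine ⟨hst, fun r' => ?_⟩
      obtain ⟨t', ht', hv'⟩ := hd _ r' hst
      exact ⟨t', ht', hs₁G _ _ _ (by simpa using ht'), hv'⟩
    constructor
    · refine star_dom.2 ⟨by simpa using hT, fun y r hy => ?_⟩
      simp only [sndB_pairB, fstB_pairB] at hy ⊢
      obtain ⟨t, -, m1, m2, m3⟩ := k1 y r hy
      refine ⟨_, m1, star_dom.2 ⟨by simpa using m2, fun w r' hw => ?_⟩⟩
      simp only [sndB_pairB, fstB_pairB] at hw ⊢
      obtain ⟨t', -, h1, h2⟩ := (m3 w hw).2 r'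
      exact ⟨t', h1, h2⟩
    · rintro b ⟨-, y, r, hy, e, he, h1, -, w, r', hw, e', he', h2, h3⟩
      simp only [sndB_pairB, fstB_pairB] at hy he
      obtain ⟨t, ht, m1, -, m3⟩ := k1 y r hy
      obtain rfl := Part.mem_unique he m1
      simp only [sndB_pairB, fstB_pairB] at hw he'
      obtain ⟨hst, m4⟩ := m3 w hw
      obtain ⟨t', ht', m5, -⟩ := m4 r'
      obtain rfl := Part.mem_unique he' m5
      exact ⟨hd, _, r', hst, e', ht', h2, h3⟩
  refine .of_total (h := fun a => pairB (s₂ a) (sndB (sndB a))) (k := fun z => sndB (sndB z))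
    (.snd (.snd .id)) (.pair hs₂ (.snd (.snd .id))) (fun a c hc => (main a ⟨c, hc⟩).1)
    (fun a b hc hb => ?_)
  simpa using (main a hc).2 b hb

/-! #### The implication -/

/-- The backward map `K` is appended to the function part of the solution, with the instance `u` as
a parameter. -/
theorem impl_mono_right (h : LE R R') : LE (impl S R) (impl S R') := by
  obtain ⟨K, H, hK, hH, h⟩ := h
  obtain ⟨s, hs, hsG⟩ := ComputableFun.smn₂ (G := fun a q =>
      (Φ (sndB a) q).bind fun t => K (pairB (fstB a) t))
    (.bind (.app (.snd (.fst .id)) (.snd .id)) (hK.comp_tot (.pair (.fst (.fst (.fst .id)))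
      (.snd .id))))
  refine ⟨_, H, ComputableTot.pair (hs.comp (.pair (.fst .id) (.fst (.snd .id))))
    (.snd (.snd .id)), hH, fun u c hc => ?_⟩
  obtain ⟨hS, v, hv⟩ := impl_dom.1 ⟨c, hc⟩
  obtain ⟨a, ha, hb, hab⟩ := h _ _ hv
  refine ⟨a, ha, impl_dom.2 ⟨hS, hb⟩, fun b hb => ⟨_, Part.mem_some _, ?_⟩⟩
  refine ⟨by simpa using hb.1, fun y r hy => ?_⟩
  simp only [sndB_pairB, fstB_pairB] at hy ⊢
  obtain ⟨t, ht, hR⟩ := hb.2 y r hy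
  obtain ⟨w, hw, hR⟩ := hab t hR
  exact ⟨w, hsG _ _ _ (Part.mem_bind (by simpa using ht) (by simpa using hw)), hR⟩

/-- The instance of `S` in a solution is sent to `S'` by `H`, and its function is precomposed with
`K`. Without `hS` the relation `impl S R` would be empty. -/
theorem impl_anti_left (hS : ∃ x y, S x y) (h : LE S S') : LE (impl S' R) (impl S R) := by
  obtain ⟨K, H, hK, hH, h⟩ := h
  obtain ⟨s, hs, hsG⟩ := ComputableFun.smn₂ (G := fun a q =>
      (K (pairB (sndB a) (fstB q))).bind fun y => Φ (fstB a) (pairB y (sndB q)))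
    ((hK.comp_tot (.pair (.snd (.fst .id)) (.fst (.snd .id)))).bind
      (.app (.fst (.fst (.fst .id))) (.pair (.snd .id) (.snd (.snd (.fst .id))))))
  refine ⟨fun z => (H (sndB (sndB z))).bind fun x => Part.some (pairB (s (sndB z)) x), _,
    (hH.comp_tot (.snd (.snd .id))).bind (.pair (hs.comp (.snd (.fst .id))) (.snd .id)),
    ComputableTot.id, fun u c hc => ?_⟩
  refine ⟨u, Part.mem_some _, impl_dom.2 ⟨hS, (impl_dom.1 ⟨c, hc⟩).2⟩, fun b hb => ?_⟩
  obtain ⟨⟨y₀, hy₀⟩, hb⟩ := hb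
  obtain ⟨x, hx, hx', hxy⟩ := h _ _ hy₀
  refine ⟨_, Part.mem_bind (by simpa using hx) (Part.mem_some _), by simpa using hx',
    fun y r hy => ?_⟩
  simp only [sndB_pairB, fstB_pairB] at hy ⊢
  obtain ⟨y', hy', hS'⟩ := hxy y hy
  obtain ⟨t, ht, hR⟩ := hb y' r hS'
  exact ⟨t, hsG _ _ _ (Part.mem_bind (by simpa using hy') (by simpa using ht)), hR⟩

end NameRel

end Weihrauch

namespace Weihrauch

namespace NameRel

variable {R S : NameRel}

/-! ### Special problems on the level of names -/

/-- The problem `1`. -/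
def one : NameRel := fun _ _ => True

/-- The problem `lim`. -/
def lim : NameRel := fun p r => ∀ n, ∃ N, ∀ i, N ≤ i → p (Nat.pair n i) = r n

open Classical in
/-- The problem `LPO`. -/
def LPO : NameRel := fun p r => (∀ n, p n < 2) ∧ r 0 = if ∀ n, p n = 0 then 1 else 0

/-- The constant problem with the only solution `c`. -/
def output (c : Baire) : NameRel := fun _ r => r = c

/-- The problem with the only instance `c` and a trivial task. -/
def input (c : Baire) : NameRel := fun q _ => q = c

theorem lim_unique {p r s : Baire} (h : lim p r) (h' : lim p s) : r = s := by
  funext n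
  obtain ⟨N, hN⟩ := h n
  obtain ⟨M, hM⟩ := h' n
  rw [← hN (max N M) (le_max_left _ _), hM _ (le_max_right _ _)]

theorem lim_zero : lim (fun _ => 0) (fun _ => 0) := fun _ => ⟨0, fun _ _ => rfl⟩

theorem LPO_zero : LPO (fun _ => 0) (fun _ => 1) := ⟨fun _ => by simp, by simp⟩

theorem one_le {c : Baire} (hc : Computable c) (h : ∃ r, R c r) : LE one R :=
  .of_total .id (.const hc) (fun _ _ _ => h) fun _ _ _ _ => trivial

/-- Every point solves `1`, so the function part of a solution `b` can be evaluated anywhere; `b`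
itself serves as answer and as padding. -/
theorem le_impl_one : LE R (impl one R) := by
  refine ⟨fun z => Φ (fstB (sndB z)) (pairB (sndB z) (sndB z)), _,
    .app (.fst (.snd .id)) (.pair (.snd .id) (.snd .id)), ComputableTot.id, fun p c hc =>
    ⟨p, Part.mem_some _, impl_dom.2 ⟨⟨p, p, trivial⟩, c, hc⟩, fun b hb => ?_⟩⟩
  simpa using hb.2 b b trivial

theorem impl_one_le : LE (impl one R) R := by
  obtain ⟨s, hs, hsG⟩ := exists_const_code
  refine .of_total (h := fun q => q) (k := fun z => pairB (s (sndB z)) (sndB z))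
    (.pair (hs.comp (.snd .id)) (.snd .id)) .id (fun p c hc => (impl_dom.1 ⟨c, hc⟩).2)
    fun p b _ hb => ⟨⟨p, trivial⟩, fun y r _ => ⟨b, by simpa using hsG b _, hb⟩⟩

theorem impl_to_one_le {c : Baire} (hc : Computable c) (h : ∃ r, S c r) :
    LE (impl S one) one := by
  obtain ⟨s, hs, hsG⟩ := exists_const_code
  refine .of_total (h := fun q => q) (k := fun _ => pairB (s c) c)
    (.const ?_) .id (fun _ _ _ => ⟨c, trivial⟩)
    fun p b _ _ => ⟨by simpa using h, fun y r _ => ⟨c, by simpa using hsG c _, trivial⟩⟩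
  exact ComputableFun.computable_of_mem (F := fun q => Part.some (pairB (s q) q))
    (.pair hs .id) hc (Part.mem_some _)

/-- The instance `u` is passed on unchanged and the identity, which drops the padding, is the
function. -/
theorem impl_self_le : LE (impl R R) one := by
  obtain ⟨s, hs, hsG⟩ := ComputableFun.smn₂ (G := fun _ q => Part.some (fstB q))
    (ComputableTot.fst (.snd .id))
  refine .of_total (h := fun q => q) (k := fun z => pairB (s (fstB z)) (fstB z))
    (.pair (hs.comp (.fst .id)) (.fst .id)) .id (fun p _ _ => ⟨p, trivial⟩) fun p b hc _ => ?_
  obtain ⟨c, hc⟩ := hc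
  obtain ⟨-, v, hv⟩ := impl_dom.1 ⟨c, hc⟩
  exact ⟨⟨v, by simpa using hv⟩, fun y r hy => ⟨y, by simpa using hsG p _ _ (by simp),
    by simpa using hy⟩⟩

theorem impl_input_one_le (c : Baire) : LE (impl (input c) one) (output c) := by
  obtain ⟨s, hs, hsG⟩ := exists_const_code
  refine .of_total (h := fun q => q) (k := fun z => pairB (s (sndB z)) (sndB z))
    (.pair (hs.comp (.snd .id)) (.snd .id)) .id (fun p _ _ => ⟨c, rfl⟩)
    fun p b _ hb => ⟨⟨p, show sndB _ = c by rw [sndB_pairB, sndB_pairB]; exact hb⟩, fun y r _ => ⟨b, by simpa using hsG b _,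
      trivial⟩⟩

/-- A solution contains an instance of `input c`, and `c` is the only one. -/
theorem le_impl_input_one (c : Baire) : LE (output c) (impl (input c) one) := by
  refine .of_total (h := fun q => q) (k := fun z => sndB (sndB z))
    (.snd (.snd .id)) .id (fun p _ _ => impl_dom.2 ⟨⟨c, c, rfl⟩, c, trivial⟩) ?_
  rintro p b - ⟨⟨y, hy⟩, -⟩
  change sndB b = c at hy
  simpa [output] using hy

theorem computable_of_output_le_one {c : Baire} (h : LE (output c) one) : Computable c := by
  obtain ⟨K, H, hK, hH, h⟩ := h
  obtain ⟨a, -, -, h⟩ := h (fun _ => 0) c rfl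
  obtain ⟨r, hr, rfl⟩ := h (fun _ => 0) trivial
  refine hK.computable_of_mem ?_ hr
  exact Primrec₂.natPair.to_comp.comp (Computable.const 0) (Computable.const 0)

/-- A reduction would make `lim` continuous, but a sequence that is zero on any given prefix and `1`
afterwards has limits `1`. -/
theorem not_lim_le_one : ¬ LE lim one := by
  rintro ⟨K, H, hK, hH, h⟩
  have h' : ∀ p r, lim p r → r ∈ K (pairB p fun _ => 0) := fun p r hp => by
    obtain ⟨a, -, -, h⟩ := h p r hp
    obtain ⟨s, hs, hps⟩ := h (fun _ => 0) trivial
    rwa [lim_unique hp hps]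
  obtain ⟨k, hk⟩ := hK.exists_use (h' _ _ lim_zero) 0
  have hlim : lim (fun m => if m < k then 0 else 1) fun _ => 1 := fun n =>
    ⟨k, fun i hi => if_neg (by have := Nat.right_le_pair n i; omega)⟩
  have := hk _ _ (h' _ _ hlim) (initSeg_congr fun j hj => by simp [pairB, hj])
  simp at this

/-! ### `lim ⋆ LPO ≡ lim` -/

/-- `LPO` is asked about the zero sequence and its answer ignored: a constant code hands `p` to
`lim`. -/
theorem lim_le_star_LPO : LE lim (star lim LPO) := by
  obtain ⟨s, hs, hsG⟩ := exists_const_code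
  refine .of_total (h := fun p => pairB (s (pairB p p)) fun _ => 0) (k := fun z => sndB (sndB z))
    (.snd (.snd .id)) (.pair (hs.comp (.pair .id .id)) .zero) (fun p c hc => ?_) ?_
  · refine star_dom.2 ⟨⟨_, by simpa using LPO_zero⟩, fun y r _ => ⟨_, by simpa using hsG _ _, c,
      by simpa using hc⟩⟩
  · rintro p b - ⟨-, y, r, -, t, ht, -, h⟩
    obtain rfl := Part.mem_unique ht (by simpa using hsG _ _)
    simpa using h

/-- The guess for the value of `LPO` from a prefix of a name `⟨h, x⟩`. -/
def guess (π : List ℕ) : ℕ := if π.findIdx (fun v => v.unpair.2 != 0) < π.length then 0 else 1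

/-- A prefix of a name of `h` and an assumed value `b` of `LPO`. -/
def assume (b : ℕ) (π : List ℕ) : List ℕ := π.map fun v => Nat.pair v.unpair.1 (Nat.pair b 0)

/-- The `i`-th approximation to the `n`-th digit of the limit. -/
def limApprox (σ : List ℕ) (n i : ℕ) : ℕ :=
  -- A digit not yet produced leaves the last known value in place, so delays of the machine do not
  -- disturb the limit.
  Nat.rec 0 (fun j m => ((Approx.univ σ (Nat.pair n j)).map fun v => v.unpair.2).getD m) i

/-- The prefix of the input of the universal function that is guessed from `π`. -/
def guessed (π : List ℕ) : List ℕ := assume (guess π) π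

/-- The `⟨n, i⟩`-th digit of the instance of `lim`, computed from a prefix of the input of the
universal function. -/
def limDigit (σ : List ℕ) (m : ℕ) : ℕ :=
  Nat.pair (((Approx.univ σ m.unpair.1).map fun v => v.unpair.1).getD 0)
    (limApprox σ m.unpair.1 m.unpair.2)

/-- The digits of the instance of `lim` that solves the instance `⟨h, x⟩` of `lim ⋆ LPO`. -/
def limInstance (π : List ℕ) (m : ℕ) : ℕ := limDigit (guessed (π.take m.unpair.2)) m

theorem primrec_guessed : Primrec guessed := by
  have hb : Primrec₂ fun (_ : List ℕ) (v : ℕ) => v.unpair.2 != 0 := by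
    refine (Primrec.not.comp ((Primrec.beq (α := ℕ)).comp
      (Primrec.snd.comp (Primrec.unpair.comp Primrec.snd)) (Primrec.const 0))).to₂
  have hguess : Primrec guess :=
    Primrec.ite (Primrec.nat_lt.comp (Primrec.list_findIdx Primrec.id hb) Primrec.list_length)
      (Primrec.const 0) (Primrec.const 1)
  refine Primrec.list_map (f := fun π : List ℕ => π)
    (g := fun π v => Nat.pair v.unpair.1 (Nat.pair (guess π) 0)) Primrec.id ?_
  exact (Primrec₂.natPair.comp (Primrec.fst.comp (Primrec.unpair.comp Primrec.snd))
    (Primrec₂.natPair.comp (hguess.comp Primrec.fst) (Primrec.const 0))).to₂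

theorem computable_limApprox :
    Computable fun x : List ℕ × ℕ × ℕ => limApprox x.1 x.2.1 x.2.2 := by
  have hu : Computable fun y : (List ℕ × ℕ × ℕ) × ℕ × ℕ =>
      Approx.univ y.1.1 (Nat.pair y.1.2.1 y.2.1) :=
    Computable₂.comp Approx.computable_univ (Computable.fst.comp Computable.fst)
      (Primrec₂.natPair.to_comp.comp
        (Computable.fst.comp (Computable.snd.comp Computable.fst))
        (Computable.fst.comp Computable.snd))
  have hs : Computable₂ fun (x : List ℕ × ℕ × ℕ) (y : ℕ × ℕ) =>
      ((Approx.univ x.1 (Nat.pair x.2.1 y.1)).map fun v => v.unpair.2).getD y.2 :=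
    Computable.option_getD (Computable.option_map hu
      (Computable.snd.comp (Computable.unpair.comp Computable.snd)).to₂)
      (Computable.snd.comp Computable.snd)
  exact Computable.nat_rec (Computable.snd.comp Computable.snd) (Computable.const 0) hs

theorem computable_limDigit : Computable₂ limDigit := by
  have h1 : Computable fun x : List ℕ × ℕ => x.2.unpair.1 :=
    (Primrec.fst.comp (Primrec.unpair.comp Primrec.snd)).to_comp
  have h2 : Computable fun x : List ℕ × ℕ => x.2.unpair.2 :=
    (Primrec.snd.comp (Primrec.unpair.comp Primrec.snd)).to_comp
  have hu : Computable fun x : List ℕ × ℕ => Approx.univ x.1 x.2.unpair.1 :=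
    Computable₂.comp Approx.computable_univ Computable.fst h1
  have hd : Computable fun x : List ℕ × ℕ =>
      ((Approx.univ x.1 x.2.unpair.1).map fun v => v.unpair.1).getD 0 :=
    Computable.option_getD (Computable.option_map hu
      (Computable.fst.comp (Computable.unpair.comp Computable.snd)).to₂) (Computable.const 0)
  have hl : Computable fun x : List ℕ × ℕ => limApprox x.1 x.2.unpair.1 x.2.unpair.2 :=
    Computable.comp (f := fun y : List ℕ × ℕ × ℕ => limApprox y.1 y.2.1 y.2.2)
      (g := fun x : List ℕ × ℕ => (x.1, x.2.unpair.1, x.2.unpair.2)) computable_limApprox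
      (Computable.fst.pair (h1.pair h2))
  have h := Computable₂.comp (f := Nat.pair) Primrec₂.natPair.to_comp hd hl
  exact h

theorem computable_limInstance : Computable₂ limInstance := by
  have ht : Primrec fun x : List ℕ × ℕ => x.1.take x.2.unpair.2 :=
    Primrec.list_take.comp (Primrec.snd.comp (Primrec.unpair.comp Primrec.snd)) Primrec.fst
  exact computable_limDigit.comp (primrec_guessed.comp ht).to_comp Computable.snd

open Classical in
theorem guess_initSeg (a : Baire) (i : ℕ) :
    guess (initSeg a i) = if ∀ j < i, sndB a j = 0 then 1 else 0 := by
  simp only [guess, List.findIdx_lt_length]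
  by_cases h : ∀ j < i, sndB a j = 0
  · rw [if_pos h, if_neg]
    simp only [initSeg, List.mem_map, List.mem_range]
    rintro ⟨_, ⟨j, hj, rfl⟩, hne⟩
    exact absurd (h j hj) (by simpa [sndB] using hne)
  · rw [if_neg h, if_pos]
    push Not at h
    obtain ⟨j, hj, hne⟩ := h
    exact ⟨a j, List.mem_map.2 ⟨j, List.mem_range.2 hj, rfl⟩, by simpa [sndB] using hne⟩

theorem eventually_guess (a : Baire) {y : Baire} (hy : LPO (sndB a) y) :
    ∃ N, ∀ i, N ≤ i → guess (initSeg a i) = y 0 := by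
  classical
  rw [hy.2]
  by_cases h : ∀ n, sndB a n = 0
  · exact ⟨0, fun i _ => by rw [guess_initSeg, if_pos h, if_pos fun j _ => h j]⟩
  · have h' := h
    push Not at h'
    obtain ⟨n, hn⟩ := h'
    refine ⟨n + 1, fun i hi => ?_⟩
    rw [guess_initSeg, if_neg h, if_neg fun h => hn (h n hi)]

theorem assume_initSeg (b : ℕ) (a : Baire) (i : ℕ) :
    assume b (initSeg a i) = initSeg (pairB (fstB a) (pairB (fun _ => b) fun _ => 0)) i := by
  simp [assume, initSeg, fstB, pairB]

/-- Column `i` simulates the machine on `i` input digits under the `i`-th guess for `LPO`. The guess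
stabilises, and from then on the simulated input is a true prefix. Each limit collects a digit of
the component that bypasses `lim` and a digit of the inner limit. -/
theorem star_LPO_le_lim : LE (star lim LPO) lim := by
  have main : ∀ a, (∃ c, star lim LPO a c) → ∃ s,
      lim (fun m => limInstance (initSeg a (m + 1)) m) s ∧ star lim LPO a s := by
    intro a hc
    obtain ⟨⟨y, hy⟩, hd⟩ := star_dom.1 hc
    -- Only the first digit of a name of the answer counts, so the constant name is also a solution;
    -- it is the one that `assume` simulates.
    have hy' : LPO (sndB a) fun _ => y 0 := ⟨hy.1, hy.2⟩
    obtain ⟨t, ht, v, hv⟩ := hd _ (fun _ => 0) hy'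
    obtain ⟨I, hI⟩ := eventually_guess a hy
    set c := pairB (fstB a) (pairB (fun _ => y 0) fun _ => 0) with hcdef
    have htc : t ∈ (fun r => Φ (fstB r) (sndB r)) c := by simpa [hcdef] using ht
    have hσ : ∀ n i, I ≤ i → guessed ((initSeg a (Nat.pair n i + 1)).take i) = initSeg c i :=
        fun n i hi => by
      rw [take_initSeg a (by have := Nat.right_le_pair n i; omega), guessed, hI i hi,
        assume_initSeg]
    refine ⟨pairB (fstB t) v, fun n => ?_, hd, _, _, hy', t, ht, by simp, by simpa using hv⟩
    obtain ⟨N, hN⟩ := hv n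
    obtain ⟨J, hJ⟩ := Approx.universal.reaches_all htc (Nat.pair n N + 1)
    obtain ⟨J', hJ'⟩ := Approx.universal.reaches_all htc (n + 1)
    -- After `I` the guess is right; `N + 1` is needed as `limApprox` inspects only indices below
    -- its last argument; by stage `J` entry `⟨n, N⟩` has been produced, and by `J'` the digit `n`
    -- of the bypassing part.
    refine ⟨max (max I (N + 1)) (max J J'), fun i hi => ?_⟩
    simp only [max_le_iff] at hi
    simp only [limInstance, limDigit, Nat.unpair_pair, hσ n i hi.1.1]
    rw [hJ' n (by omega) i hi.2.2]
    have hlim : ∀ k, N < k → limApprox (initSeg c i) n k = v n := by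
      intro k hk
      induction hk with
      | refl =>
        change ((Approx.univ (initSeg c i) (Nat.pair n N)).map _).getD _ = _
        rw [hJ _ (by omega) i hi.2.1]
        exact hN N le_rfl
      | @step k hk ih =>
        change ((Approx.univ (initSeg c i) (Nat.pair n k)).map _).getD
          (limApprox (initSeg c i) n k) = _
        cases hm : Approx.univ (initSeg c i) (Nat.pair n k) with
        | none => exact ih
        | some m =>
          rw [Approx.universal.eq_of_mem htc hm]
          exact hN k (Nat.le_of_succ_le hk)
    rw [hlim i hi.1.2]
    rfl
  refine .of_total (k := fun z => sndB z) (.snd .id)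
    (.of_use Computable.succ computable_limInstance)
    (fun a c hc => (main a ⟨c, hc⟩).imp fun _ h => h.1) fun a b hc hb => ?_
  obtain ⟨s, hs, hs'⟩ := main a hc
  rw [sndB_pairB, lim_unique hb hs]
  exact hs'

/-! ### `lim` is strictly below `LPO ⋆ lim` -/

/-- The limit bypasses `LPO` in the Baire component, while `LPO` receives the zero sequence. -/
theorem lim_le_LPO_star : LE lim (star LPO lim) := by
  obtain ⟨s, hs, hsG⟩ := ComputableFun.smn₂ (G := fun _ q =>
    Part.some (pairB (fstB q) fun _ => 0)) (.pair (.fst (.snd .id)) .zero)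
  refine .of_total (h := fun p => pairB (s p) p) (k := fun z => fstB (sndB z))
    (.fst (.snd .id)) (.pair hs .id) (fun p c hc => ?_) ?_
  · exact star_dom.2 ⟨⟨c, by simpa using hc⟩, fun y r _ => ⟨_, by
      simpa using hsG _ _ _ (Part.mem_some _), _, by simpa using LPO_zero⟩⟩
  · rintro p b - ⟨-, y, r, hy, t, ht, h, -⟩
    obtain rfl := Part.mem_unique ht (by simpa using hsG _ _ _ (Part.mem_some _))
    simpa [h] using hy

/-- A convergent double sequence whose `n`-th limit says whether the `n`-th row of `q` is zero. -/
def rowTest (q : Baire) : Baire := fun m =>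
  if ∑ j ∈ Finset.range (m.unpair.2 + 1), q (Nat.pair m.unpair.1 j) = 0 then 1 else 0

theorem continuous_rowTest : Continuous rowTest := by
  refine continuous_pi fun m => ?_
  exact (continuous_of_discreteTopology (f := fun x : ℕ => if x = 0 then 1 else 0)).comp
    (continuous_finsetSum _ fun j _ => continuous_apply _)

open Classical in
theorem lim_rowTest (q : Baire) :
    lim (rowTest q) fun n => if ∀ j, q (Nat.pair n j) = 0 then 1 else 0 := by
  intro n
  simp only [rowTest, Nat.unpair_pair, Finset.sum_eq_zero_iff, Finset.mem_range]
  by_cases h : ∀ j, q (Nat.pair n j) = 0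
  · exact ⟨0, fun i _ => by rw [if_pos h, if_pos fun j _ => h j]⟩
  · have h' := h
    push Not at h'
    obtain ⟨j, hj⟩ := h'
    exact ⟨j, fun i hi => by rw [if_neg h, if_neg fun h => hj (h j (by omega))]⟩

/-- Every row of `q` has a nonzero entry. -/
def RowsNonzero (q : Baire) : Prop := ∀ n, ∃ j, q (Nat.pair n j) ≠ 0

-- On the instance `A q`, `LPO` is applied to the limits of `rowTest q`, which are all zero exactly
-- if every row of `q` has a nonzero entry. The Baire category theorem rules out that `lim` decides
-- this.
open Classical in
theorem not_LPO_star_le_lim : ¬ LE (star LPO lim) lim := by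
  rintro ⟨K, H, hK, hH, h⟩
  obtain ⟨s, hs, hsG⟩ := ComputableFun.smn₂ (G := fun _ q =>
    Part.some (pairB (fun _ => 0) (fstB q))) (.pair .zero (.fst (.snd .id)))
  set A : Baire → Baire := fun q => pairB (s fun _ => 0) (rowTest q) with hA
  have hcode : ∀ y r, pairB (fun _ => 0) y ∈ Φ (s fun _ => 0) (pairB y r) := fun y r => by
    simpa using hsG (fun _ => 0) (pairB y r) _ (Part.mem_some _)
  have hdom : ∀ q, ∃ e, star LPO lim (A q) e := fun q => star_dom.2
    ⟨⟨_, by simpa [hA] using lim_rowTest q⟩, fun y r hy => ⟨_, by simpa [hA] using hcode y r, by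
      simp only [hA, sndB_pairB] at hy
      rw [lim_unique hy (lim_rowTest q)]
      refine ⟨fun _ => _, fun n => ?_, rfl⟩
      simp only [sndB_pairB]
      split_ifs <;> omega⟩⟩
  have hsol : ∀ q e, star LPO lim (A q) e → (sndB e 0 = 1 ↔ RowsNonzero q) := by
    rintro q e ⟨-, y, r, hy, t, ht, -, -, he⟩
    obtain rfl := Part.mem_unique ht (by simpa [hA] using hcode y r)
    simp only [hA, sndB_pairB] at hy he
    obtain rfl := lim_unique hy (lim_rowTest q)
    simp [he, RowsNonzero]
  have hall : ∀ q, ∃ a b e, a ∈ H (A q) ∧ lim a b ∧ e ∈ K (pairB (A q) b) ∧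
      (sndB e 0 = 1 ↔ RowsNonzero q) := fun q => by
    obtain ⟨e, he⟩ := hdom q
    obtain ⟨a, ha, ⟨b, hb⟩, hab⟩ := h _ _ he
    obtain ⟨r, hr, hr'⟩ := hab b hb
    exact ⟨a, b, r, ha, hb, hr, hsol q r hr'⟩
  choose a b e ha hb he hrow using hall
  have hAc : Continuous A := by
    refine continuous_pi fun m => ?_
    exact (continuous_of_discreteTopology (f := fun x : ℕ => Nat.pair (s (fun _ => 0) m) x)).comp
      ((continuous_apply m).comp continuous_rowTest)
  have hac : Continuous a := hH.continuous hAc ha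
  obtain ⟨φ, hφ⟩ := hK.exists_approx
  -- `C (σ, N)` collects the `q` for which `σ` already determines the first output digit and agrees
  -- with `⟨A q, a q ⟨·, i⟩⟩` for all `i ≥ N`. These are closed conditions, as `A` and `a` are
  -- continuous.
  let C : List ℕ × ℕ → Set Baire := fun x => {q | (φ x.1 0).isSome ∧ ∀ j v, x.1[j]? = some v →
    ∀ i, x.2 ≤ i → Nat.pair (A q j) (a q (Nat.pair j i)) = v}
  have hclosed : ∀ x, IsClosed (C x) := by
    intro x
    simp only [C, Set.ofPred_and, Set.ofPred_forall]
    refine isClosed_const.inter (isClosed_iInter fun j => isClosed_iInter fun v =>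
      isClosed_iInter fun _ => isClosed_iInter fun i => isClosed_iInter fun _ => ?_)
    refine isClosed_eq ?_ continuous_const
    exact (continuous_of_discreteTopology (f := fun y : ℕ × ℕ => Nat.pair y.1 y.2)).comp
      (((continuous_apply j).comp hAc).prodMk ((continuous_apply _).comp hac))
  have hcover : ⋃ x, C x = Set.univ := by
    refine Set.eq_univ_of_forall fun q => ?_
    obtain ⟨k, hk⟩ := hφ.reaches _ _ (he q) 0
    choose N hN using hb q
    refine Set.mem_iUnion.2 ⟨(initSeg (pairB (A q) (b q)) k, (Finset.range k).sup N), by simp [hk],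
      fun j v hj i hi => ?_⟩
    have hjk : j < k := by simpa using (List.getElem?_eq_some_iff.1 hj).1
    rw [getElem?_initSeg _ hjk] at hj
    rw [← Option.some.inj hj, hN j i ((Finset.le_sup (Finset.mem_range.2 hjk)).trans hi)]
    rfl
  have hconst : ∀ x, ∀ q ∈ C x, ∀ q' ∈ C x, (RowsNonzero q ↔ RowsNonzero q') := by
    rintro ⟨σ, N⟩
    have hval : ∀ q ∈ C (σ, N), φ σ 0 = some (e q 0) := by
      rintro q ⟨h1, h2⟩
      -- Entries that agree from `N` on agree with the limit, so `σ` is a prefix of the actual input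
      -- of `K`.
      have hσ : σ = initSeg (pairB (A q) (b q)) σ.length := by
        refine List.ext_getElem (by simp) fun j hj _ => ?_
        obtain ⟨M, hM⟩ := hb q j
        rw [getElem_initSeg, ← h2 j σ[j] (by simp [hj]) (max N M) (le_max_left _ _),
          hM _ (le_max_right _ _)]
        rfl
      obtain ⟨m, hm⟩ := Option.isSome_iff_exists.1 h1
      simp only at hm
      rw [hm]
      rw [hσ] at hm
      rw [hφ.eq_of_mem (he q) hm]
    intro q hq q' hq'
    have := Option.some.inj ((hval q hq).symm.trans (hval q' hq'))
    rw [← hrow q, ← hrow q', sndB, sndB, this]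
  obtain ⟨x, q, hq⟩ := nonempty_interior_of_iUnion_of_closed hclosed hcover
  have htend : ∀ c : ℕ, ∀ᶠ k in atTop, (fun m => if m < k then q m else c) ∈ C x := fun c => by
    have : Tendsto (fun k : ℕ => (fun m => if m < k then q m else c : Baire)) atTop (𝓝 q) := by
      refine tendsto_pi_nhds.2 fun m => tendsto_const_nhds.congr' ?_
      filter_upwards [eventually_gt_atTop m] with k hk
      rw [if_pos hk]
    exact (this.eventually (isOpen_interior.mem_nhds hq)).mono fun _ h => interior_subset h
  obtain ⟨k, h0, h1⟩ := ((htend 0).and (htend 1)).exists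
  -- Since `Nat.pair n j` is at least `n` and `j`, entry `k` of every row is `1` here, whereas with
  -- tail `0` the whole row `k` vanishes.
  have hP : RowsNonzero fun m => if m < k then q m else 1 := fun n =>
    ⟨k, by have := Nat.right_le_pair n k; simp only [if_neg this.not_gt]; exact one_ne_zero⟩
  obtain ⟨j, hj⟩ := (hconst x _ h1 _ h0).1 hP k
  have := Nat.left_le_pair k j
  simp [this] at hj

end NameRel

end Weihrauch

namespace Weihrauch

/-! ### Passing from problems to relations on names -/

/-- The problem on names that a multi-valued function on represented spaces induces. -/
def nameRel {X Y : RepSpace.{u}} (f : MultiFun X Y) : NameRel :=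
  fun p r => ∃ x ∈ X.δ p, ∃ y ∈ Y.δ r, y ∈ f x

section

variable {U V X Y : RepSpace.{u}} {f : MultiFun U V} {g : MultiFun X Y}

theorem exists_nameRel {p : Baire} {x : U.carrier} (hx : x ∈ U.δ p) (h : x ∈ f.dom) :
    ∃ r, nameRel f p r := by
  obtain ⟨y, hy⟩ := h
  obtain ⟨r, hr⟩ := V.surj y
  exact ⟨r, x, hx, y, hr, hy⟩

theorem dom_nonempty_iff : f.dom.Nonempty ↔ ∃ p r, nameRel f p r := by
  constructor
  · rintro ⟨x, hx⟩
    obtain ⟨p, hp⟩ := U.surj x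
    exact ⟨p, exists_nameRel hp hx⟩
  · rintro ⟨p, r, x, -, y, -, hy⟩
    exact ⟨x, y, hy⟩

theorem realizes_iff {F : Baire →. Baire} :
    Realizes F f ↔ ∀ p c, nameRel f p c → ∃ r ∈ F p, nameRel f p r := by
  constructor
  · rintro h p c ⟨x, hx, y, -, hy⟩
    obtain ⟨r, hr, z, hz, hz'⟩ := h p x hx ⟨y, hy⟩
    exact ⟨r, hr, x, hx, z, hz, hz'⟩
  · rintro h p x hx hd
    obtain ⟨c, hc⟩ := exists_nameRel hx hd
    obtain ⟨r, hr, x', hx', y, hy, hy'⟩ := h p c hc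
    obtain rfl := Part.mem_unique hx hx'
    exact ⟨r, hr, y, hy, hy'⟩

open Classical in
theorem exists_realizes (f : MultiFun U V) : ∃ F, Realizes F f := by
  refine ⟨fun p => ⟨∃ c, nameRel f p c, fun h => h.choose⟩, realizes_iff.2 fun p c hc => ?_⟩
  have h : ∃ c, nameRel f p c := ⟨c, hc⟩
  exact ⟨h.choose, ⟨h, rfl⟩, h.choose_spec⟩

-- The query `a` from `H` does not depend on the realizer `G`. Changing `G` at the single point `a`
-- tests the reduction: undefined at `a`, to see that `a` must have a solution, and with value `b`,
-- to see that every solution `b` must work.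
open Classical in
theorem wle_of_iff : WLE (.of f) (.of g) ↔ NameRel.LE (nameRel f) (nameRel g) := by
  constructor
  · rintro ⟨K, H, hK, hH, h⟩
    refine ⟨K, H, hK, hH, fun p c hc => ?_⟩
    have h' := fun G (hG : Realizes G g) => realizes_iff.1 (h G hG) p c hc
    obtain ⟨G, hG⟩ := exists_realizes g
    obtain ⟨r₀, hr₀, -⟩ := h' G hG
    obtain ⟨a, ha, -⟩ := Part.mem_bind_iff.1 hr₀
    refine ⟨a, ha, ?_, fun b hb => ?_⟩
    · by_contra hne
      push Not at hne
      obtain ⟨r, hr, -⟩ := h' (fun q => if q = a then Part.none else G q)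
        (realizes_iff.2 fun q d hd => by
          rw [if_neg (by rintro rfl; exact hne d hd)]
          exact realizes_iff.1 hG q d hd)
      obtain ⟨a', ha', hr⟩ := Part.mem_bind_iff.1 hr
      obtain rfl := Part.mem_unique ha ha'
      simp at hr
    · obtain ⟨r, hr, hr'⟩ := h' (fun q => if q = a then Part.some b else G q)
        (realizes_iff.2 fun q d hd => by
          by_cases hq : q = a
          · subst hq
            exact ⟨b, by simp, hb⟩
          · rw [if_neg hq]
            exact realizes_iff.1 hG q d hd)
      obtain ⟨a', ha', hr⟩ := Part.mem_bind_iff.1 hr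
      obtain rfl := Part.mem_unique ha ha'
      refine ⟨r, ?_, hr'⟩
      simpa using hr
  · rintro ⟨K, H, hK, hH, h⟩
    refine ⟨K, H, hK, hH, fun G hG => realizes_iff.2 fun p c hc => ?_⟩
    obtain ⟨a, ha, ⟨b, hb⟩, hab⟩ := h p c hc
    obtain ⟨b', hb', hab'⟩ := realizes_iff.1 hG a b hb
    obtain ⟨r, hr, hpr⟩ := hab b' hab'
    exact ⟨r, Part.mem_bind ha (Part.mem_bind hb' hr), hpr⟩

/-! ### The operations on the level of names -/

theorem mem_prod_δ {X Y : RepSpace.{u}} {p : Baire} {z : (X.prod Y).carrier} :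
    z ∈ (X.prod Y).δ p ↔ z.1 ∈ X.δ (fstB p) ∧ z.2 ∈ Y.δ (sndB p) := by
  constructor
  · rintro ⟨⟨h1, h2⟩, rfl⟩
    exact ⟨⟨h1, rfl⟩, ⟨h2, rfl⟩⟩
  · obtain ⟨x, y⟩ := z
    rintro ⟨⟨h1, rfl⟩, ⟨h2, rfl⟩⟩
    exact ⟨⟨h1, h2⟩, rfl⟩

theorem nameRel_prod : nameRel (X := U.prod X) (Y := V.prod Y) (Multi.prod f g) =
    NameRel.times (nameRel f) (nameRel g) := by
  funext p r
  refine propext ⟨?_, ?_⟩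
  · rintro ⟨x, hx, y, hy, hxy⟩
    obtain ⟨hx1, hx2⟩ := mem_prod_δ.1 hx
    obtain ⟨hy1, hy2⟩ := mem_prod_δ.1 hy
    exact ⟨⟨_, hx1, _, hy1, hxy.1⟩, ⟨_, hx2, _, hy2, hxy.2⟩⟩
  · rintro ⟨⟨x, hx, y, hy, hxy⟩, ⟨x', hx', y', hy', hxy'⟩⟩
    exact ⟨(x, x'), mem_prod_δ.2 ⟨hx, hx'⟩, (y, y'), mem_prod_δ.2 ⟨hy, hy'⟩, hxy, hxy'⟩

theorem mem_phi {p : Baire} {x : X.carrier} {z : Y.carrier} : z ∈ RepSpace.phi X Y p x ↔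
    (∀ q, x ∈ X.δ (fstB q) → ∃ t ∈ Φ p q, ∃ w, w ∈ Y.δ t) ∧
      ∃ q, x ∈ X.δ (fstB q) ∧ ∃ t ∈ Φ p q, z ∈ Y.δ t := by
  constructor
  · rintro ⟨h1, t, ⟨h2, q, hq, ht⟩, hz⟩
    refine ⟨fun q' hq' => ?_, q, hq, t, ht, hz⟩
    obtain ⟨t', ht'⟩ := h2 q' hq'
    obtain ⟨w, hw⟩ := h1 t' ⟨h2, q', hq', ht'⟩
    exact ⟨t', ht', w, hw⟩
  · rintro ⟨h, q, hq, t, ht, hz⟩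
    refine ⟨?_, t, ⟨fun q' hq' => ?_, q, hq, ht⟩, hz⟩
    · rintro t' ⟨-, q', hq', ht'⟩
      obtain ⟨t'', ht'', w, hw⟩ := h q' hq'
      obtain rfl := Part.mem_unique ht' ht''
      exact ⟨w, hw⟩
    · obtain ⟨t', ht', -⟩ := h q' hq'
      exact ⟨t', ht'⟩

theorem mem_dom_phi {p : Baire} {x : X.carrier} : x ∈ (RepSpace.phi X Y p).dom ↔
    ∀ q, x ∈ X.δ (fstB q) → ∃ t ∈ Φ p q, ∃ w, w ∈ Y.δ t := by
  constructor
  · rintro ⟨z, hz⟩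
    exact (mem_phi.1 hz).1
  · intro h
    obtain ⟨q, hq⟩ := X.surj x
    have hq' : x ∈ X.δ (fstB (pairB q q)) := by simpa using hq
    obtain ⟨t, ht, w, hw⟩ := h _ hq'
    exact ⟨w, mem_phi.2 ⟨h, _, hq', t, ht, hw⟩⟩

theorem mem_phi_comp {p : Baire} {x : X.carrier} {z : U.carrier} :
    z ∈ (RepSpace.phi Y U p).comp g x ↔
      (∀ y ∈ g x, ∀ q, y ∈ Y.δ (fstB q) → ∃ t ∈ Φ p q, ∃ w, w ∈ U.δ t) ∧
        ∃ y ∈ g x, ∃ q, y ∈ Y.δ (fstB q) ∧ ∃ t ∈ Φ p q, z ∈ U.δ t := by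
  constructor
  · rintro ⟨h, y, hy, hz⟩
    obtain ⟨-, h'⟩ := mem_phi.1 hz
    exact ⟨fun y hy => mem_dom_phi.1 (h y hy), y, hy, h'⟩
  · rintro ⟨h, y, hy, h'⟩
    exact ⟨fun y hy => mem_dom_phi.2 (h y hy), y, hy, mem_phi.2 ⟨h y hy, h'⟩⟩

theorem mem_M_prod {a : Baire} {z : ((RepSpace.M Y U).prod X).carrier}
    (hz : z ∈ ((RepSpace.M Y U).prod X).δ a) :
    z.1.1 = RepSpace.phi Y U (fstB a) ∧ z.2 ∈ X.δ (sndB a) := by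
  obtain ⟨h1, h2⟩ := mem_prod_δ.1 hz
  exact ⟨congrArg Subtype.val (Part.mem_some_iff.1 h1), h2⟩

theorem mem_baire_δ {p : Baire} {q : RepSpace.baire.{u}.carrier} :
    q ∈ RepSpace.baire.{u}.δ p ↔ q.down = p := by
  refine Part.mem_some_iff.trans ⟨fun h => by rw [h], fun h => ?_⟩
  cases q
  exact congrArg ULift.up h

/-- Cylinder names of `y` are pairs of a name and a padding `r`. The convention that a composition
is defined only if all intermediate values are in the domain becomes the quantifier over all `y` and
`r`. -/
theorem nameRel_star : nameRel (starFun f g) = NameRel.star (nameRel f) (nameRel g) := by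
  funext a s
  refine propext ⟨?_, ?_⟩
  · rintro ⟨z, hz, ⟨q, v⟩, hv, ⟨hd, ⟨q', u⟩, hu, hq, hfv⟩⟩
    obtain ⟨hz1, hz2⟩ := mem_M_prod hz
    obtain ⟨hv1, hv2⟩ := mem_prod_δ.1 hv
    simp only [transpose, hz1] at hd hu
    obtain ⟨hall, y, hy, r, hr, t, ht, hut⟩ := mem_phi_comp.1 hu
    obtain ⟨hut1, hut2⟩ := mem_prod_δ.1 hut
    refine ⟨?_, ?_⟩
    · rintro y' r' ⟨x', hx', y'', hy'', hg⟩
      obtain rfl := Part.mem_unique hx' hz2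
      have hr' : y'' ∈ Y.δ (fstB (pairB y' r')) := by simpa using hy''
      obtain ⟨t', ht', w, hw⟩ := hall y'' hg _ hr'
      refine ⟨t', ht', ?_⟩
      obtain ⟨w', hw'⟩ := hd w (mem_phi_comp.2 ⟨hall, y'', hg, _, hr', t', ht', hw⟩)
      exact exists_nameRel (mem_prod_δ.1 hw).2 ⟨w'.2, hw'.2⟩
    · refine ⟨fstB r, sndB r, ⟨z.2, hz2, y, hr, hy⟩, t, by simpa using ht, ?_,
        ⟨u, hut2, v, hv2, hfv⟩⟩
      have e : q = q' := hq
      rw [← mem_baire_δ.1 hv1, ← mem_baire_δ.1 hut1, e]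
  · rintro ⟨hall, y, r, ⟨x, hx, y', hy', hg⟩, t, ht, hst, u, hu, v, hv, hfv⟩
    let m : (RepSpace.M Y (RepSpace.baire.prod U)).carrier := ⟨RepSpace.phi _ _ (fstB a), _, rfl⟩
    have hall' : ∀ y ∈ g x, ∀ q, y ∈ Y.δ (fstB q) →
        ∃ t ∈ Φ (fstB a) q, ∃ v, nameRel f (sndB t) v := fun y hy q hq => by
      obtain ⟨t, ht, v, hv⟩ := hall (fstB q) (sndB q) ⟨x, hx, y, hq, hy⟩
      exact ⟨t, by simpa using ht, v, hv⟩
    refine ⟨(m, x), mem_prod_δ.2 ⟨Part.mem_some _, hx⟩, (⟨fstB s⟩, v),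
      mem_prod_δ.2 ⟨mem_baire_δ.2 rfl, hv⟩, ?_, (⟨fstB s⟩, u), ?_, rfl, hfv⟩
    · rintro ⟨q, w⟩ hw
      obtain ⟨-, y'', hy'', q'', hq'', t'', ht'', hw''⟩ := mem_phi_comp.1 hw
      obtain ⟨t', ht', v', u', hu', b, -, hb'⟩ := hall' _ hy'' _ hq''
      obtain rfl := Part.mem_unique ht' ht''
      obtain rfl := Part.mem_unique hu' (mem_prod_δ.1 hw'').2
      exact ⟨(q, b), rfl, hb'⟩
    · refine mem_phi_comp.2 ⟨fun y hy q hq => ?_, y', hg, pairB y r, by simpa using hy', t, ht,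
        mem_prod_δ.2 ⟨mem_baire_δ.2 hst, hu⟩⟩
      obtain ⟨t', ht', v', u', hu', -⟩ := hall' _ hy _ hq
      exact ⟨t', ht', (⟨fstB t'⟩, u'), mem_prod_δ.2 ⟨mem_baire_δ.2 rfl, hu'⟩⟩

theorem nameRel_impl : nameRel (implFun g f) = NameRel.impl (nameRel g) (nameRel f) := by
  funext u a
  refine propext ⟨?_, ?_⟩
  · rintro ⟨u', hu', z, hz, ⟨w, hw⟩, hsub⟩
    obtain ⟨hz1, hz2⟩ := mem_M_prod hz
    simp only [hz1] at hw hsub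
    obtain ⟨hall, y, hy, r, hr, -⟩ := mem_phi_comp.1 hw
    refine ⟨⟨fstB r, _, hz2, y, hr, hy⟩, ?_⟩
    rintro y' r' ⟨x', hx', y'', hy'', hg⟩
    obtain rfl := Part.mem_unique hx' hz2
    have hr' : y'' ∈ Y.δ (fstB (pairB y' r')) := by simpa using hy''
    obtain ⟨t', ht', w, hw⟩ := hall y'' hg _ hr'
    exact ⟨t', ht', u', hu', w, hw, hsub (mem_phi_comp.2 ⟨hall, y'', hg, _, hr', t', ht', hw⟩)⟩
  · rintro ⟨⟨y, x, hx, y', hy', hg⟩, hall⟩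
    let m : (RepSpace.M Y V).carrier := ⟨RepSpace.phi _ _ (fstB a), _, rfl⟩
    have hall' : ∀ y ∈ g x, ∀ q, y ∈ Y.δ (fstB q) →
        ∃ t ∈ Φ (fstB a) q, nameRel f u t := fun y hy q hq => by
      obtain ⟨t, ht, h⟩ := hall (fstB q) (sndB q) ⟨x, hx, y, hq, hy⟩
      exact ⟨t, by simpa using ht, h⟩
    have hdom : ∀ y ∈ g x, ∀ q, y ∈ Y.δ (fstB q) → ∃ t ∈ Φ (fstB a) q, ∃ w, w ∈ V.δ t :=
        fun y hy q hq => by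
      obtain ⟨t, ht, -, -, w, hw, -⟩ := hall' y hy q hq
      exact ⟨t, ht, w, hw⟩
    have hy₁ : y' ∈ Y.δ (fstB (pairB y y)) := by simpa using hy'
    obtain ⟨t, ht, u', hu', v, hv, -⟩ := hall' y' hg _ hy₁
    refine ⟨u', hu', (m, x), mem_prod_δ.2 ⟨Part.mem_some _, hx⟩,
      ⟨v, mem_phi_comp.2 ⟨hdom, y', hg, _, hy₁, t, ht, hv⟩⟩, fun w hw => ?_⟩
    obtain ⟨-, y'', hy'', q'', hq'', t'', ht'', hw''⟩ := mem_phi_comp.1 hw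
    obtain ⟨t', ht', u'', hu'', b, hb, hb'⟩ := hall' _ hy'' _ hq''
    obtain rfl := Part.mem_unique ht' ht''
    obtain rfl := Part.mem_unique hu' hu''
    obtain rfl := Part.mem_unique hb hw''
    exact hb'

end

end Weihrauch

/-! ### Problems including `∞` and the relations that represent them -/

namespace Weihrauch

/-- The problem `P` is induced by a multi-valued function that behaves like `R` on names. -/
def Problem.Represents (P : Problem.{u}) (R : NameRel) : Prop :=
  ∃ (X Y : RepSpace.{u}) (f : MultiFun X Y), P = .of f ∧ nameRel f = R

namespace Problem

variable {P P' Q Q' : Problem.{u}} {R S : NameRel}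

theorem eq_infty_or_represents (P : Problem.{u}) : P = infty ∨ ∃ R, P.Represents R := by
  cases P with
  | infty => exact .inl rfl
  | of f => exact .inr ⟨_, _, _, f, rfl, rfl⟩

theorem wle_infty (P : Problem.{u}) : WLE P infty :=
  ⟨_, _, ComputableTot.id, ComputableTot.id, fun _ hG => hG.elim⟩

/-- Every multi-valued function has a realizer, by choice, and a reduction would turn it into one of
`∞`. -/
theorem eq_infty_of_wle (h : WLE infty P) : P = infty := by
  cases P with
  | infty => rfl
  | of f =>
    obtain ⟨K, H, -, -, h⟩ := h
    obtain ⟨G, hG⟩ := exists_realizes f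
    exact (h G hG).elim

theorem times_infty (P : Problem.{u}) : times P infty = infty := by cases P <;> rfl

theorem infty_times (P : Problem.{u}) : times infty P = infty := by cases P <;> rfl

theorem star_infty (P : Problem.{u}) : star P infty = infty := by cases P <;> rfl

theorem infty_star (P : Problem.{u}) : star infty P = infty := by cases P <;> rfl

namespace Represents

theorem wle_iff (hP : P.Represents R) (hQ : Q.Represents S) : WLE P Q ↔ NameRel.LE R S := by
  obtain ⟨X, Y, f, rfl, rfl⟩ := hP
  obtain ⟨U, V, g, rfl, rfl⟩ := hQ
  exact wle_of_iff

theorem wEquiv (hP : P.Represents R) (hQ : Q.Represents S) (h : NameRel.LE R S)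
    (h' : NameRel.LE S R) : WEquiv P Q :=
  ⟨(hP.wle_iff hQ).2 h, (hQ.wle_iff hP).2 h'⟩

theorem ne_infty (hP : P.Represents R) : P ≠ infty := by
  obtain ⟨X, Y, f, rfl, rfl⟩ := hP
  exact nofun

theorem times (hP : P.Represents R) (hQ : Q.Represents S) :
    (P.times Q).Represents (R.times S) := by
  obtain ⟨X, Y, f, rfl, rfl⟩ := hP
  obtain ⟨U, V, g, rfl, rfl⟩ := hQ
  exact ⟨_, _, _, rfl, nameRel_prod⟩

theorem star (hP : P.Represents R) (hQ : Q.Represents S) :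
    (P.star Q).Represents (R.star S) := by
  obtain ⟨X, Y, f, rfl, rfl⟩ := hP
  obtain ⟨U, V, g, rfl, rfl⟩ := hQ
  exact ⟨_, _, _, rfl, nameRel_star⟩

theorem impl (hQ : Q.Represents S) (hP : P.Represents R)
    (h : (∃ x y, S x y) ∨ ∀ u v, ¬ R u v) : (impl Q P).Represents (S.impl R) := by
  obtain ⟨X, Y, f, rfl, rfl⟩ := hP
  obtain ⟨U, V, g, rfl, rfl⟩ := hQ
  refine ⟨_, _, implFun g f, if_pos ?_, nameRel_impl⟩
  refine h.imp dom_nonempty_iff.2 fun h => ?_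
  rw [← Set.not_nonempty_iff_eq_empty, dom_nonempty_iff]
  push Not
  exact h

theorem impl_eq_infty (hQ : Q.Represents S) (hP : P.Represents R) (h : ∀ x y, ¬ S x y)
    (h' : ∃ u v, R u v) : Problem.impl Q P = infty := by
  obtain ⟨X, Y, f, rfl, rfl⟩ := hP
  obtain ⟨U, V, g, rfl, rfl⟩ := hQ
  refine if_neg ?_
  rw [← Set.not_nonempty_iff_eq_empty, dom_nonempty_iff, dom_nonempty_iff]
  push Not
  exact ⟨h, h'⟩

theorem impl_infty (hQ : Q.Represents S) : Problem.impl Q infty = infty := by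
  obtain ⟨U, V, g, rfl, rfl⟩ := hQ
  rfl

theorem zero : Problem.zero.{u}.Represents fun _ _ => False := by
  refine ⟨_, _, _, rfl, ?_⟩
  funext p r
  refine eq_false ?_
  rintro ⟨x, -, y, -, h⟩
  exact h

theorem one : Problem.one.{u}.Represents NameRel.one := by
  refine ⟨_, _, _, rfl, ?_⟩
  funext p r
  exact eq_true ⟨PUnit.unit, Part.mem_some _, PUnit.unit, Part.mem_some _, rfl⟩

theorem lim : Problem.lim.{u}.Represents NameRel.lim := by
  refine ⟨_, _, _, rfl, ?_⟩
  funext p r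
  have key : ∀ p r : Baire, (∀ n, Tendsto (fun i => p (Nat.pair n i)) atTop (𝓝 (r n))) ↔
      NameRel.lim p r := fun p r => by
    simp only [nhds_discrete, tendsto_pure, eventually_atTop, NameRel.lim]
  refine propext ⟨?_, fun h => ?_⟩
  · rintro ⟨x, hx, y, hy, h⟩
    rw [← mem_baire_δ.1 hx, ← mem_baire_δ.1 hy]
    exact (key _ _).1 h
  · exact ⟨⟨p⟩, mem_baire_δ.2 rfl, ⟨r⟩, mem_baire_δ.2 rfl, (key _ _).2 h⟩

theorem LPO : Problem.LPO.{u}.Represents NameRel.LPO := by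
  classical
  refine ⟨_, _, _, rfl, ?_⟩
  funext p r
  refine propext ⟨?_, ?_⟩
  · rintro ⟨x, ⟨hp, rfl⟩, y, ⟨hr, rfl⟩, h⟩
    refine ⟨hp, ?_⟩
    have e : (∀ n, (⟨p n, hp n⟩ : Fin 2) = 0) ↔ ∀ n, p n = 0 :=
      forall_congr' fun n => Fin.ext_iff
    have h := congrArg (fun b : ULift (Fin 2) => (b.down : ℕ)) (Set.mem_singleton_iff.1 h)
    by_cases h0 : ∀ n, p n = 0
    · rw [if_pos h0]
      exact h.trans (congrArg (fun b : ULift.{u} (Fin 2) => (b.down : ℕ)) (if_pos (e.2 h0)))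
    · rw [if_neg h0]
      exact h.trans (congrArg (fun b : ULift.{u} (Fin 2) => (b.down : ℕ)) (if_neg (mt e.1 h0)))
  · rintro ⟨hp, hr⟩
    have e : (∀ n, (⟨p n, hp n⟩ : Fin 2) = 0) ↔ ∀ n, p n = 0 :=
      forall_congr' fun n => Fin.ext_iff
    have hr2 : r 0 < 2 := by rw [hr]; split_ifs <;> omega
    refine ⟨⟨fun n => ⟨p n, hp n⟩⟩, ⟨hp, rfl⟩, ⟨⟨r 0, hr2⟩⟩, ⟨hr2, rfl⟩, ?_⟩
    refine Set.mem_singleton_iff.2 (ULift.ext _ _ (Fin.ext ?_))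
    by_cases h0 : ∀ n, p n = 0
    · have h1 : (if ∀ n, (⟨p n, hp n⟩ : Fin 2) = 0 then (⟨1⟩ : ULift.{u} (Fin 2)) else ⟨0⟩) = ⟨1⟩ :=
        if_pos (e.2 h0)
      exact (hr.trans (if_pos h0)).trans (congrArg (fun b => (b.down : ℕ)) h1).symm
    · have h1 : (if ∀ n, (⟨p n, hp n⟩ : Fin 2) = 0 then (⟨1⟩ : ULift.{u} (Fin 2)) else ⟨0⟩) = ⟨0⟩ :=
        if_neg (mt e.1 h0)
      exact (hr.trans (if_neg h0)).trans (congrArg (fun b => (b.down : ℕ)) h1).symm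

theorem mem_point_δ {p : ℕ → Fin 2} {q : Baire} :
    (∃ x, x ∈ (point.{u} p).δ q) ↔ q = fun n => (p n : ℕ) := by
  constructor
  · rintro ⟨x, ⟨hq, h⟩, -⟩
    funext n
    exact congrArg (fun x : RepSpace.cantor.{u}.carrier => (x.down n : ℕ)) h
  · rintro rfl
    exact ⟨⟨⟨p⟩, rfl⟩, ⟨fun n => (p n).isLt, rfl⟩, rfl⟩

theorem c (p : ℕ → Fin 2) : (Problem.c.{u} p).Represents (NameRel.output fun n => (p n : ℕ)) := by
  refine ⟨_, _, _, rfl, ?_⟩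
  funext q r
  refine propext ⟨?_, fun h => ?_⟩
  · rintro ⟨x, -, y, hy, -⟩
    exact mem_point_δ.1 ⟨y, hy⟩
  · obtain ⟨y, hy⟩ := mem_point_δ.2 h
    exact ⟨PUnit.unit, Part.mem_some _, y, hy, trivial⟩

theorem d (p : ℕ → Fin 2) : (Problem.d.{u} p).Represents (NameRel.input fun n => (p n : ℕ)) := by
  refine ⟨_, _, _, rfl, ?_⟩
  funext q r
  refine propext ⟨?_, fun h => ?_⟩
  · rintro ⟨x, hx, -⟩
    exact mem_point_δ.1 ⟨x, hx⟩
  · obtain ⟨y, hy⟩ := mem_point_δ.2 h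
    exact ⟨y, hy, PUnit.unit, Part.mem_some _, trivial⟩

end Represents

/-! ### Algebraic laws for arbitrary problems -/

theorem wle_trans {O : Problem.{u}} (h : WLE P Q) (h' : WLE Q O) : WLE P O := by
  obtain rfl | ⟨T, hO⟩ := O.eq_infty_or_represents
  · exact wle_infty P
  obtain rfl | ⟨S, hQ⟩ := Q.eq_infty_or_represents
  · exact absurd (eq_infty_of_wle h') hO.ne_infty
  obtain rfl | ⟨R, hP⟩ := P.eq_infty_or_represents
  · exact absurd (eq_infty_of_wle h) hQ.ne_infty
  exact (hP.wle_iff hO).2 (((hP.wle_iff hQ).1 h).trans ((hQ.wle_iff hO).1 h'))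

theorem wEquiv_trans {O : Problem.{u}} (h : WEquiv P Q) (h' : WEquiv Q O) : WEquiv P O :=
  ⟨wle_trans h.1 h'.1, wle_trans h'.2 h.2⟩

theorem wEquiv_symm (h : WEquiv P Q) : WEquiv Q P := ⟨h.2, h.1⟩

theorem wle_refl (P : Problem.{u}) : WLE P P := by
  obtain rfl | ⟨R, hP⟩ := P.eq_infty_or_represents
  · exact wle_infty _
  · exact (hP.wle_iff hP).2 (.refl R)

theorem times_assoc (f g h : Problem.{u}) :
    WEquiv (times (times f g) h) (times f (times g h)) := by
  obtain rfl | ⟨R, hf⟩ := f.eq_infty_or_represents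
  · simp only [infty_times]; exact ⟨wle_infty _, wle_infty _⟩
  obtain rfl | ⟨S, hg⟩ := g.eq_infty_or_represents
  · simp only [infty_times, times_infty]; exact ⟨wle_infty _, wle_infty _⟩
  obtain rfl | ⟨T, hh⟩ := h.eq_infty_or_represents
  · simp only [times_infty]; exact ⟨wle_infty _, wle_infty _⟩
  exact ((hf.times hg).times hh).wEquiv (hf.times (hg.times hh)) NameRel.times_assoc_le
    NameRel.times_assoc_ge

theorem star_assoc (f g h : Problem.{u}) : WEquiv (star (star f g) h) (star f (star g h)) := by
  obtain rfl | ⟨R, hf⟩ := f.eq_infty_or_represents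
  · simp only [infty_star]; exact ⟨wle_infty _, wle_infty _⟩
  obtain rfl | ⟨S, hg⟩ := g.eq_infty_or_represents
  · simp only [infty_star, star_infty]; exact ⟨wle_infty _, wle_infty _⟩
  obtain rfl | ⟨T, hh⟩ := h.eq_infty_or_represents
  · simp only [star_infty]; exact ⟨wle_infty _, wle_infty _⟩
  exact ((hf.star hg).star hh).wEquiv (hf.star (hg.star hh)) NameRel.star_assoc_le
    NameRel.star_assoc_ge

theorem times_comm_wle (f g : Problem.{u}) : WLE (times f g) (times g f) := by
  obtain rfl | ⟨R, hf⟩ := f.eq_infty_or_represents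
  · rw [times_infty]; exact wle_infty _
  obtain rfl | ⟨S, hg⟩ := g.eq_infty_or_represents
  · rw [infty_times]; exact wle_infty _
  exact ((hf.times hg).wle_iff (hg.times hf)).2 NameRel.times_comm_le

theorem times_mono (h : WLE P P') (h' : WLE Q Q') : WLE (times P Q) (times P' Q') := by
  obtain rfl | ⟨R', hP'⟩ := P'.eq_infty_or_represents
  · rw [infty_times]; exact wle_infty _
  obtain rfl | ⟨S', hQ'⟩ := Q'.eq_infty_or_represents
  · rw [times_infty]; exact wle_infty _
  obtain rfl | ⟨R, hP⟩ := P.eq_infty_or_represents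
  · exact absurd (eq_infty_of_wle h) hP'.ne_infty
  obtain rfl | ⟨S, hQ⟩ := Q.eq_infty_or_represents
  · exact absurd (eq_infty_of_wle h') hQ'.ne_infty
  exact ((hP.times hQ).wle_iff (hP'.times hQ')).2
    (NameRel.times_mono ((hP.wle_iff hP').1 h) ((hQ.wle_iff hQ').1 h'))

theorem star_mono (h : WLE P P') (h' : WLE Q Q') : WLE (star P Q) (star P' Q') := by
  obtain rfl | ⟨R', hP'⟩ := P'.eq_infty_or_represents
  · rw [infty_star]; exact wle_infty _
  obtain rfl | ⟨S', hQ'⟩ := Q'.eq_infty_or_represents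
  · rw [star_infty]; exact wle_infty _
  obtain rfl | ⟨R, hP⟩ := P.eq_infty_or_represents
  · exact absurd (eq_infty_of_wle h) hP'.ne_infty
  obtain rfl | ⟨S, hQ⟩ := Q.eq_infty_or_represents
  · exact absurd (eq_infty_of_wle h') hQ'.ne_infty
  exact ((hP.star hQ).wle_iff (hP'.star hQ')).2
    (NameRel.star_mono ((hP.wle_iff hP').1 h) ((hQ.wle_iff hQ').1 h'))

/-- If `Q` has no instances, the right side is `∞` unless `P'` has none either; then neither has
`P`, and the left side is nowhere defined. -/
theorem impl_mono_right (h : WLE P P') : WLE (impl Q P) (impl Q P') := by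
  obtain rfl | ⟨S, hQ⟩ := Q.eq_infty_or_represents
  · exact wle_refl _
  obtain rfl | ⟨R', hP'⟩ := P'.eq_infty_or_represents
  · rw [hQ.impl_infty]; exact wle_infty _
  obtain rfl | ⟨R, hP⟩ := P.eq_infty_or_represents
  · exact absurd (eq_infty_of_wle h) hP'.ne_infty
  have hRR' := (hP.wle_iff hP').1 h
  by_cases hS : ∃ x y, S x y
  · exact ((hQ.impl hP (.inl hS)).wle_iff (hQ.impl hP' (.inl hS))).2 (NameRel.impl_mono_right hRR')
  push Not at hS
  by_cases hR' : ∃ u v, R' u v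
  · rw [hQ.impl_eq_infty hP' hS hR']; exact wle_infty _
  push Not at hR'
  have hR : ∀ u v, ¬ R u v := fun u v huv => by
    obtain ⟨K, H, -, -, h⟩ := hRR'
    obtain ⟨a, -, ⟨b, hb⟩, -⟩ := h u v huv
    exact hR' a b hb
  refine ((hQ.impl hP (.inr hR)).wle_iff (hQ.impl hP' (.inr hR'))).2 (.of_empty fun u a ha => ?_)
  obtain ⟨-, v, hv⟩ := NameRel.impl_dom.1 ⟨a, ha⟩
  exact hR u v hv

theorem impl_anti_left (h : WLE Q Q') : WLE (impl Q' P) (impl Q P) := by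
  obtain rfl | ⟨S', hQ'⟩ := Q'.eq_infty_or_represents
  · obtain h0 | ⟨T, hT⟩ := (impl Q P).eq_infty_or_represents
    · rw [h0]; exact wle_infty _
    · exact (Represents.zero.wle_iff hT).2 (.of_empty fun _ _ h => h)
  obtain rfl | ⟨S, hQ⟩ := Q.eq_infty_or_represents
  · exact absurd (eq_infty_of_wle h) hQ'.ne_infty
  obtain rfl | ⟨R, hP⟩ := P.eq_infty_or_represents
  · rw [hQ.impl_infty]; exact wle_infty _
  have hSS' := (hQ.wle_iff hQ').1 h
  by_cases hR : ∃ u v, R u v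
  · by_cases hS : ∃ x y, S x y
    · have hS' : ∃ x y, S' x y := by
        obtain ⟨K, H, -, -, h⟩ := hSS'
        obtain ⟨x, y, hxy⟩ := hS
        obtain ⟨a, -, hb, -⟩ := h x y hxy
        exact ⟨a, hb⟩
      exact ((hQ'.impl hP (.inl hS')).wle_iff (hQ.impl hP (.inl hS))).2
        (NameRel.impl_anti_left hS hSS')
    · push Not at hS
      rw [hQ.impl_eq_infty hP hS hR]; exact wle_infty _
  · push Not at hR
    refine ((hQ'.impl hP (.inr hR)).wle_iff (hQ.impl hP (.inr hR))).2 (.of_empty fun u a ha => ?_)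
    obtain ⟨-, v, hv⟩ := NameRel.impl_dom.1 ⟨a, ha⟩
    exact hR u v hv

theorem impl_congr (h : WEquiv P P') (h' : WEquiv Q Q') : WEquiv (impl Q P) (impl Q' P') :=
  ⟨wle_trans (impl_mono_right h.1) (impl_anti_left h'.2),
    wle_trans (impl_mono_right h.2) (impl_anti_left h'.1)⟩

/-! ### The counterexamples -/

theorem computable_zero : Computable fun _ : ℕ => 0 := Computable.const 0

theorem one_dom : (∃ x y, NameRel.one x y) := ⟨fun _ => 0, fun _ => 0, trivial⟩

theorem lim_dom : (∃ x y, NameRel.lim x y) := ⟨_, _, NameRel.lim_zero⟩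

theorem wlt_one_lim : WLT one.{u} lim := by
  refine ⟨(Represents.one.wle_iff Represents.lim).2
    (NameRel.one_le computable_zero ⟨_, NameRel.lim_zero⟩), fun h => ?_⟩
  exact NameRel.not_lim_le_one ((Represents.lim.wle_iff Represents.one).1 h)

theorem impl_one_wEquiv (hP : P.Represents R) : WEquiv (impl one P) P :=
  (Represents.one.impl hP (.inl one_dom)).wEquiv hP NameRel.impl_one_le NameRel.le_impl_one

theorem impl_to_one_wEquiv {c : Baire} (hQ : Q.Represents S) (hc : Computable c)
    (h : ∃ r, S c r) : WEquiv (impl Q one) one :=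
  (hQ.impl .one (.inl ⟨c, h⟩)).wEquiv .one (NameRel.impl_to_one_le hc h)
    (NameRel.one_le computable_zero (NameRel.impl_dom.2 ⟨⟨c, h⟩, c, trivial⟩))

theorem impl_lim_lim_wEquiv : WEquiv (impl lim.{u} lim) one :=
  (Represents.lim.impl .lim (.inl lim_dom)).wEquiv .one NameRel.impl_self_le
    (NameRel.one_le computable_zero (NameRel.impl_dom.2 ⟨lim_dom, _, NameRel.lim_zero⟩))

theorem impl_lim_one_wEquiv : WEquiv (impl lim.{u} one) one :=
  impl_to_one_wEquiv .lim computable_zero ⟨_, NameRel.lim_zero⟩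

theorem wEquiv_refl (P : Problem.{u}) : WEquiv P P := ⟨wle_refl P, wle_refl P⟩

theorem impl_d_one_wEquiv (p : ℕ → Fin 2) : WEquiv (impl (d.{u} p) one) (c p) :=
  ((Represents.d p).impl .one (.inl ⟨_, fun _ => 0, rfl⟩)).wEquiv (.c p) (NameRel.impl_input_one_le _)
    (NameRel.le_impl_input_one _)

theorem impl_c_one_wEquiv (p : ℕ → Fin 2) : WEquiv (impl (c.{u} p) one) one :=
  impl_to_one_wEquiv (.c p) computable_zero ⟨_, rfl⟩

theorem wlt_one_c {p : ℕ → Fin 2} (hp : ¬ Computable p) : WLT one.{u} (c p) := by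
  refine ⟨(Represents.one.wle_iff (.c p)).2 (NameRel.one_le computable_zero ⟨_, rfl⟩), fun h => ?_⟩
  have := NameRel.computable_of_output_le_one (((Represents.c p).wle_iff .one).1 h)
  -- The inclusion of `Fin 2` in `ℕ` is its encoding.
  exact hp (Computable.encode_iff.1 this)

theorem wlt_lim_star_LPO_lim : WLT lim.{u} (star LPO lim) :=
  ⟨(Represents.lim.wle_iff (Represents.LPO.star .lim)).2 NameRel.lim_le_LPO_star,
    fun h => NameRel.not_LPO_star_le_lim (((Represents.LPO.star .lim).wle_iff .lim).1 h)⟩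

theorem star_lim_LPO_wEquiv : WEquiv (star lim LPO) lim.{u} :=
  (Represents.lim.star .LPO).wEquiv .lim NameRel.star_LPO_le_lim NameRel.lim_le_star_LPO

theorem impl_lim_impl_lim_lim_wEquiv : WEquiv (impl lim.{u} (impl lim lim)) one :=
  wEquiv_trans (impl_congr impl_lim_lim_wEquiv (wEquiv_refl _)) impl_lim_one_wEquiv

theorem impl_impl_lim_lim_lim_wEquiv : WEquiv (impl (impl lim.{u} lim) lim) lim :=
  wEquiv_trans (impl_congr (wEquiv_refl _) impl_lim_lim_wEquiv) (impl_one_wEquiv .lim)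

end Problem

end Weihrauch

open Weihrauch Weihrauch.Problem in
theorem proposition32 :
    -- associativity
    (∀ f g h : Problem.{u}, WEquiv (times (times f g) h) (times f (times g h))) ∧
    (∀ f g h : Problem.{u}, WEquiv (star (star f g) h) (star f (star g h))) ∧
    (¬ ∀ f g h : Problem.{u}, WEquiv (impl (impl f g) h) (impl f (impl g h))) ∧
    -- monotonicity in both components
    (∀ f f' g g' : Problem.{u}, WLE f f' → WLE g g' → WLE (times f g) (times f' g')) ∧
    (∀ f f' g g' : Problem.{u}, WLE f f' → WLE g g' → WLE (star f g) (star f' g')) ∧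
    -- monotonicity in the second and antimonotonicity in the first component
    (∀ g f f' : Problem.{u}, WLE f f' → WLE (impl g f) (impl g f')) ∧
    (∀ g g' f : Problem.{u}, WLE g g' → WLE (impl g' f) (impl g f)) ∧
    -- commutativity
    (∀ f g : Problem.{u}, WEquiv (times f g) (times g f)) ∧
    (¬ ∀ f g : Problem.{u}, WEquiv (star f g) (star g f)) ∧
    (¬ ∀ f g : Problem.{u}, WEquiv (impl f g) (impl g f)) ∧
    -- the counterexample to commutativity of the compositional product
    (WEquiv (star lim LPO) lim.{u} ∧ WLT lim.{u} (star LPO lim)) ∧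
    -- the counterexample to commutativity of the implication
    (WEquiv (impl lim one) one.{u} ∧ WLT one lim.{u} ∧ WEquiv lim.{u} (impl one lim)) ∧
    -- the counterexamples to associativity of the implication, in both directions
    (WEquiv (impl lim (impl lim lim)) one.{u} ∧ WLT one lim.{u} ∧
      WEquiv lim.{u} (impl (impl lim lim) lim)) ∧
    (∀ p : ℕ → Fin 2, ¬ Computable p →
      WEquiv (impl (impl (d p) one) one) (impl (c.{u} p) one) ∧
      WEquiv (impl (c.{u} p) one) one ∧ WLT one (c.{u} p) ∧
      WEquiv (c.{u} p) (impl (d p) (impl one one))) := by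
  refine ⟨times_assoc, star_assoc, fun h => ?_, fun _ _ _ _ => times_mono,
    fun _ _ _ _ => star_mono, fun _ _ _ => impl_mono_right, fun _ _ _ => impl_anti_left,
    fun f g => ⟨times_comm_wle f g, times_comm_wle g f⟩, fun h => ?_, fun h => ?_,
    ⟨star_lim_LPO_wEquiv, wlt_lim_star_LPO_lim⟩,
    ⟨impl_lim_one_wEquiv, wlt_one_lim, wEquiv_symm (impl_one_wEquiv .lim)⟩,
    ⟨impl_lim_impl_lim_lim_wEquiv, wlt_one_lim, wEquiv_symm impl_impl_lim_lim_lim_wEquiv⟩,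
    fun p hp => ⟨impl_congr (wEquiv_refl _) (impl_d_one_wEquiv p), impl_c_one_wEquiv p,
      wlt_one_c hp, wEquiv_symm (wEquiv_trans
        (impl_congr (impl_one_wEquiv .one) (wEquiv_refl _)) (impl_d_one_wEquiv p))⟩⟩
  -- Each refuted law would close a chain of reductions, here `lim ≤ ((lim → lim) → lim) ≤ (lim →
  -- (lim → lim)) ≤ 1`.
  · exact wlt_one_lim.2 (wle_trans impl_impl_lim_lim_lim_wEquiv.2
      (wle_trans (h lim lim lim).1 impl_lim_impl_lim_lim_wEquiv.1))
  · exact wlt_lim_star_LPO_lim.2 (wle_trans (h LPO lim).1 star_lim_LPO_wEquiv.1)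
  · exact wlt_one_lim.2 (wle_trans (impl_one_wEquiv .lim).2
      (wle_trans (h one lim).1 impl_lim_one_wEquiv.1))
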